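/- **Theorem (quasi-tree expansion of the Bollobás–Riordan polynomial).** Let $G$ be a connected finite ribbon graph (orientable or not), and let $\prec$ be a total order on its edge set $E(G)$. *Notation.* For $H\subseteq E(G)$ let $F_H$ be the spanning ribbon subgraph of $G$ with all the vertices of $G$ and with edge set $H$. For a graph or spanning ribbon subgraph $F$, let $v(F)$, $e(F)$ and $k(F)=c(F)$ be its numbers of vertices, edges and connected components, and $n(F)=e(F)-v(F)+k(F)$ its nullity; for a ribbon graph let $bc(F)$ be its number of boundary components. The Bollobás–Riordan polynomial of $G$ is $$BR_G(X,Y,Z)=\sum_{F\subseteq G}X^{k(F)-k(G)}\,Y^{n(F)}\,Z^{k(F)+n(F)-bc(F)},$$ the sum being over all spanning ribbon subgraphs, and the Tutte polynomial of a graph $\Gamma$ is normalized as $$T_\Gamma(X,Y)=\sum_{F\subseteq \Gamma}X^{k(F)-k(\Gamma)}\,Y^{n(F)},$$ the sum being over all spanning subgraphs. A quasi-tree of $G$ is a spanning ribbon subgraph $Q$ with $bc(Q)=1$; let $\mathcal Q_G$ be the set of all quasi-trees of $G$. For $Q\in\mathcal Q_G$ the partial dual $G^{E(Q)}$ (glue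 a disc to each boundary component of $Q$ in $G$, take these discs as the new vertices and remove the interiors of the old vertices) has exactly one vertex. Two edges link each other if their ribbons are met alternately along the boundary of this vertex. An edge is live with respect to $Q$ if it links no $\prec$-lower edge, and dead otherwise; it is internal if it belongs to $Q$, and external otherwise; it is orientable (nonorientable) if it is an orientable (nonorientable) loop of $G^{E(Q)}$. Let $\mathcal I_o(Q)$ be the set of internal live orientable edges, $\mathcal E_o(Q)$ the set of external live orientable edges, and $\mathcal{VI}(Q)$ the set of internal edges which are dead, or live and nonorientable. Let $G_Q$ be the graph whose vertices are the connected components of $F_{\mathcal{VI}(Q)}$ and whose edges are the edges in $\mathcal I_o(Q)$. *Claim.* Then $$BR_G(X,Y,Z)=\sum_{Q\in\mathcal Q_G}Y^{\,n(F_{\mathcal{VI}(Q)})}\;Z^{\,(k+n-bc)(F_{\mathcal{VI}(Q)})}\;(1+Y)^{|\mathcal E_o(Q)|}\;T_{G_Q}(X,YZ^2).$$ -/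

import Mathlib

/-! ### Multigraphs: connected components, nullity and the Tutte polynomial -/

/-- The connected component of the vertex `x` in the multigraph `G`, as a set of vertices. -/
def Graph.componentOf {α β : Type*} (G : Graph α β) (x : α) : Set α :=
  {y | Relation.ReflTransGen G.Adj x y}

/-- The set of connected components of the multigraph `G`. -/
def Graph.components {α β : Type*} (G : Graph α β) : Set (Set α) :=
  G.componentOf '' G.vertexSet

/-- `c(G)`, the number of connected components. -/
noncomputable def Graph.numComponents {α β : Type*} (G : Graph α β) : ℕ :=
  G.components.ncard

/-- The nullity `n(G) = e(G) - v(G) + c(G)`. The subtraction is never truncated for a finite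
graph, see `Graph.nullity_add_card`. -/
noncomputable def Graph.nullity {α β : Type*} (G : Graph α β) : ℕ :=
  (G.edgeSet.ncard + G.numComponents) - G.vertexSet.ncard

open Classical in
/-- The Tutte polynomial in the normalization
`T_G(X, Y) = ∑_F X ^ (c(F) - c(G)) * Y ^ n(F)`, the sum being over all spanning subgraphs `F` of `G`.
The first subtraction is never truncated, see `Graph.numComponents_le_restrict`. -/
noncomputable def Graph.tuttePolynomial {α β : Type*} [Fintype β] (G : Graph α β) :
    MvPolynomial (Fin 2) ℤ :=
  ∑ F ∈ Finset.univ.filter (fun F : Finset β => (F : Set β) ⊆ G.edgeSet),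
    MvPolynomial.X 0 ^ ((G.restrict F).numComponents - G.numComponents) *
      MvPolynomial.X 1 ^ (G.restrict F).nullity

theorem Graph.componentOf_eq {α β : Type*} (G : Graph α β) {x y : α}
    (h : Relation.ReflTransGen G.Adj x y) : G.componentOf x = G.componentOf y := by
  have hs : Std.Symm G.Adj := ⟨fun a b ⟨e, he⟩ => ⟨e, he.symm⟩⟩
  have h' : Relation.ReflTransGen G.Adj y x := Std.Symm.symm _ _ h
  ext z
  exact ⟨fun hz => h'.trans hz, fun hz => h.trans hz⟩

theorem Graph.componentOf_eq_iff {α β : Type*} (G : Graph α β) {x y : α} :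
    G.componentOf x = G.componentOf y ↔ Relation.ReflTransGen G.Adj x y := by
  refine ⟨fun h => ?_, G.componentOf_eq⟩
  have : y ∈ G.componentOf x := h ▸ (Relation.ReflTransGen.refl : y ∈ G.componentOf y)
  exact this

/-- Deleting edges does not decrease the number of components. -/
theorem Graph.numComponents_le_restrict {α β : Type*} [Finite α] (G : Graph α β) (F : Set β) :
    G.numComponents ≤ (G.restrict F).numComponents := by
  have hsub : G.components ⊆
      (fun S : Set α => ⋃ y ∈ S, G.componentOf y) '' (G.restrict F).components := by
    rintro _ ⟨x, hx, rfl⟩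
    refine ⟨_, ⟨x, hx, rfl⟩, ?_⟩
    have key : ∀ y ∈ (G.restrict F).componentOf x, G.componentOf y = G.componentOf x := by
      intro y hy
      refine (G.componentOf_eq (Relation.ReflTransGen.mono ?_ _ _ hy)).symm
      rintro a b ⟨e, he⟩
      exact ⟨e, he.2⟩
    apply subset_antisymm
    · exact Set.iUnion₂_subset fun y hy => (key y hy).le
    · exact Set.subset_biUnion_of_mem (u := fun y => G.componentOf y)
        (Relation.ReflTransGen.refl : x ∈ (G.restrict F).componentOf x)
  exact (Set.ncard_le_ncard hsub (Set.toFinite _)).trans (Set.ncard_image_le (Set.toFinite _))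

/-- A bound for the rank of a matrix whose kernel consists of functions of a label. -/
theorem matrix_card_le_rank_add {m n γ : Type*} [Fintype m] [Fintype n] [Finite γ]
    (M : Matrix m n (ZMod 2)) (p : n → γ)
    (h : ∀ f : n → ZMod 2, M.mulVec f = 0 → ∀ x y, p x = p y → f x = f y) :
    Fintype.card n ≤ M.rank + Nat.card γ := by
  classical
  have := Fintype.ofFinite γ
  have h1 := LinearMap.finrank_range_add_finrank_ker M.mulVecLin
  rw [Module.finrank_fintype_fun_eq_card] at h1
  have h2 : LinearMap.ker M.mulVecLin ≤
      LinearMap.range (LinearMap.funLeft (ZMod 2) (ZMod 2) p) := by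
    intro f hf
    have hf' : M.mulVec f = 0 := by simpa using hf
    refine ⟨fun c => if hc : ∃ x, p x = c then f hc.choose else 0, ?_⟩
    ext x
    have hx : ∃ y, p y = p x := ⟨x, rfl⟩
    simp only [LinearMap.funLeft_apply]
    rw [dif_pos hx]
    exact h f hf' _ _ hx.choose_spec
  have h3 := Submodule.finrank_mono h2
  have h4 := LinearMap.finrank_range_le (LinearMap.funLeft (ZMod 2) (ZMod 2) p)
  rw [Module.finrank_fintype_fun_eq_card] at h4
  rw [Nat.card_eq_fintype_card]
  have h5 : M.rank = Module.finrank (ZMod 2) (LinearMap.range M.mulVecLin) := rfl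
  omega

/-- A bound for the rank of an incidence matrix modulo 2, for a choice of the ends of the edges. -/
theorem Graph.card_le_rank_add {α β ε : Type*} [Fintype ε] [Finite α]
    (G : Graph α β) [Fintype G.vertexSet] [DecidableEq G.vertexSet] (s t : ε → G.vertexSet)
    (hst : ∀ x y : G.vertexSet, G.Adj x y → ∃ e, (x = s e ∧ y = t e) ∨ (x = t e ∧ y = s e)) :
    G.vertexSet.ncard ≤ (Matrix.of fun (e : ε) (x : G.vertexSet) =>
      ((if s e = x then 1 else 0) + (if t e = x then 1 else 0) : ZMod 2)).rank +
        G.numComponents := by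
  have key := matrix_card_le_rank_add (Matrix.of fun (e : ε) (x : G.vertexSet) =>
      ((if s e = x then 1 else 0) + (if t e = x then 1 else 0) : ZMod 2))
    (fun x => (⟨G.componentOf x, x, x.2, rfl⟩ : G.components)) (by
      intro f hf
      have hf1 : ∀ e, f (s e) = f (t e) := by
        intro e
        have := congrFun hf e
        simp only [Matrix.mulVec, dotProduct, Matrix.of_apply, add_mul, Finset.sum_add_distrib,
          ite_mul, one_mul, zero_mul, Finset.sum_ite_eq, Finset.mem_univ, if_true,
          Pi.zero_apply] at this
        exact CharTwo.add_eq_zero.1 this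
      have hadj : ∀ x y : G.vertexSet, G.Adj x y → f x = f y := by
        intro x y h
        obtain ⟨e, ⟨rfl, rfl⟩ | ⟨rfl, rfl⟩⟩ := hst x y h
        · exact hf1 e
        · exact (hf1 e).symm
      rintro ⟨x, hx⟩ ⟨y, hy⟩ hxy
      have hR : Relation.ReflTransGen G.Adj x y :=
        G.componentOf_eq_iff.1 (congrArg Subtype.val hxy)
      clear hxy
      induction hR with
      | refl => rfl
      | @tail b c hb hbc ih =>
        obtain ⟨e, he⟩ := hbc
        exact (ih he.left_mem).trans (hadj ⟨b, he.left_mem⟩ ⟨c, hy⟩ ⟨e, he⟩))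
  rwa [← Nat.card_eq_fintype_card, Nat.card_coe_set_eq, Nat.card_coe_set_eq] at key

theorem Graph.nullity_add_card {α β : Type*} [Finite α] [Finite β] (G : Graph α β) :
    G.nullity + G.vertexSet.ncard = G.edgeSet.ncard + G.numComponents := by
  classical
  have := Fintype.ofFinite G.vertexSet
  have := Fintype.ofFinite G.edgeSet
  have hl : ∀ e : G.edgeSet, ∃ x y : G.vertexSet, G.IsLink e x y := by
    rintro ⟨e, he⟩
    obtain ⟨x, y, h⟩ := (G.edge_mem_iff_exists_isLink e).1 he
    exact ⟨⟨x, h.left_mem⟩, ⟨y, h.right_mem⟩, h⟩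
  choose s t hs using hl
  have h1 := G.card_le_rank_add s t (by
    rintro x y ⟨e, he⟩
    refine ⟨⟨e, he.edge_mem⟩, ?_⟩
    obtain ⟨a, b⟩ | ⟨a, b⟩ := he.eq_and_eq_or_eq_and_eq (hs ⟨e, he.edge_mem⟩)
    · exact Or.inl ⟨Subtype.ext a, Subtype.ext b⟩
    · exact Or.inr ⟨Subtype.ext a, Subtype.ext b⟩)
  have h2 := Matrix.rank_le_card_height (Matrix.of fun (e : G.edgeSet) (x : G.vertexSet) =>
      ((if s e = x then 1 else 0) + (if t e = x then 1 else 0) : ZMod 2))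
  rw [← Nat.card_eq_fintype_card, Nat.card_coe_set_eq] at h2
  unfold Graph.nullity
  omega

/-! ### Ribbon graphs -/

/-- The four corners of each edge ribbon: `(e, i, j)` is the corner of the ribbon `e`
at its end `i` and on its side `j`. -/
abbrev Corner (E : Type*) := E × Bool × Bool

/-- The other corner at the same end of the same ribbon. -/
def Corner.alongEnd {E : Type*} (d : Corner E) : Corner E := (d.1, d.2.1, !d.2.2)

/-- The other corner on the same side of the same ribbon. -/
def Corner.alongSide {E : Type*} (d : Corner E) : Corner E := (d.1, !d.2.1, d.2.2)

/-- A ribbon graph (orientable or not) with set of edges `E`, in terms of its handle decomposition. Each edge `e : E` is a ribbon, that is, a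
rectangle with the four corners `(e, i, j)`, glued along its two ends `i = false, true` to the
boundary circles of the vertex discs. What remains of these circles is a disjoint union of arcs
that join corners of ribbons, and of the whole boundary circles of those
vertex discs to which no ribbon is glued. Hence the surface is determined by the fixed point free
involution `arc`, which sends a corner to the other endpoint of the arc that starts there, and by
the number `isolated` of vertex discs without ribbons. Conversely, all such data occur: the other
vertex discs are glued along the circles formed by the arcs and by the ends of the ribbons. -/
structure RibbonGraph (E : Type*) where
  arc : Corner E → Corner E
  arc_arc : ∀ d, arc (arc d) = d
  arc_ne : ∀ d, arc d ≠ d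
  isolated : ℕ

namespace RibbonGraph

/-- The vertices (0-handles): the circles formed by the arcs and the ends of the ribbons,
and the isolated vertices. -/
def Vertex {E : Type*} (G : RibbonGraph E) : Type _ :=
  Quot (fun d d' : Corner E => d' = G.arc d ∨ d' = d.alongEnd) ⊕ Fin G.isolated

/-- The vertex at which the corner `d` lies. -/
def vertexAt {E : Type*} (G : RibbonGraph E) (d : Corner E) : G.Vertex :=
  Sum.inl (Quot.mk _ d)

/-- The underlying graph of a ribbon graph: the edge `e` joins the vertices at its two ends. -/
def toGraph {E : Type*} (G : RibbonGraph E) : Graph G.Vertex E where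
  vertexSet := Set.univ
  IsLink e x y := ∃ i, x = G.vertexAt (e, i, false) ∧ y = G.vertexAt (e, !i, false)
  edgeSet := Set.univ
  isLink_symm := fun e _ => ⟨by
    rintro x y ⟨i, hx, hy⟩
    exact ⟨!i, hy, by simpa using hx⟩⟩
  eq_or_eq_of_isLink_of_isLink := by
    rintro e x y v w ⟨i, rfl, rfl⟩ ⟨j, rfl, rfl⟩
    cases i <;> cases j <;> simp
  edge_mem_iff_exists_isLink := fun e =>
    ⟨fun _ => ⟨_, _, false, rfl, rfl⟩, fun _ => trivial⟩
  left_mem_of_isLink := fun _ _ _ _ => trivial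

/-- The underlying graph of the spanning ribbon subgraph `F_H`, which consists of all the vertices
of `G` and of the edges in `H`. -/
def spanning {E : Type*} (G : RibbonGraph E) (H : Finset E) : Graph G.Vertex E :=
  G.toGraph.restrict H

/-- Following the boundary of `F_H` from a corner away from the arc which ends there, one runs
along the side of the ribbon if it belongs to `H`; if not, the ribbon is absent and one runs along
the segment of the boundary of the vertex disc to which its end was glued. -/
def boundaryStep {E : Type*} [DecidableEq E] (H : Finset E) (d : Corner E) : Corner E :=
  if d.1 ∈ H then d.alongSide else d.alongEnd

/-- The boundary components of the spanning ribbon subgraph `F_H`. -/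
def BoundaryComponent {E : Type*} [DecidableEq E] (G : RibbonGraph E) (H : Finset E) : Type _ :=
  Quot (fun d d' : Corner E => d' = G.arc d ∨ d' = boundaryStep H d) ⊕ Fin G.isolated

/-- `bc(F_H)`, the number of boundary components of `F_H`. -/
noncomputable def bc {E : Type*} [DecidableEq E] (G : RibbonGraph E) (H : Finset E) : ℕ :=
  Nat.card (G.BoundaryComponent H)

/-- `s(F_H) = c(F_H) + n(F_H) - bc(F_H)`, the Euler genus of `F_H` (the sum over the components
of twice the genus of an orientable and of the nonorientable genus of a nonorientable one).
The subtraction is never truncated, see `RibbonGraph.eulerGenus_add_bc`. -/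
noncomputable def eulerGenus {E : Type*} [DecidableEq E] (G : RibbonGraph E) (H : Finset E) : ℕ :=
  ((G.spanning H).numComponents + (G.spanning H).nullity) - G.bc H

instance finite_vertex {E : Type*} [Finite E] (G : RibbonGraph E) : Finite G.Vertex := by
  unfold Vertex; infer_instance

instance finite_boundaryComponent {E : Type*} [Finite E] [DecidableEq E] (G : RibbonGraph E) (H : Finset E) :
    Finite (G.BoundaryComponent H) := by
  unfold BoundaryComponent; infer_instance

theorem vertexAt_arc {E : Type*} (G : RibbonGraph E) (d : Corner E) :
    G.vertexAt (G.arc d) = G.vertexAt d := by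
  refine congrArg Sum.inl (Eq.symm ?_)
  apply Quot.sound
  exact Or.inl rfl

theorem vertexAt_alongEnd {E : Type*} (G : RibbonGraph E) (d : Corner E) :
    G.vertexAt d.alongEnd = G.vertexAt d := by
  refine congrArg Sum.inl (Eq.symm ?_)
  apply Quot.sound
  exact Or.inr rfl

/-- The boundary component of `F_H` which passes through the corner `d`. -/
def boundaryAt {E : Type*} [DecidableEq E] (G : RibbonGraph E) (H : Finset E) (d : Corner E) :
    G.BoundaryComponent H :=
  Sum.inl (Quot.mk _ d)

theorem boundaryAt_arc {E : Type*} [DecidableEq E] (G : RibbonGraph E) (H : Finset E)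
    (d : Corner E) : G.boundaryAt H (G.arc d) = G.boundaryAt H d := by
  refine congrArg Sum.inl (Eq.symm ?_)
  apply Quot.sound
  exact Or.inl rfl

theorem boundaryAt_boundaryStep {E : Type*} [DecidableEq E] (G : RibbonGraph E) (H : Finset E)
    (d : Corner E) : G.boundaryAt H (boundaryStep H d) = G.boundaryAt H d := by
  refine congrArg Sum.inl (Eq.symm ?_)
  apply Quot.sound
  exact Or.inr rfl

theorem vertexAt_side {E : Type*} (G : RibbonGraph E) (e : E) (i j : Bool) :
    G.vertexAt (e, i, j) = G.vertexAt (e, i, false) := by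
  cases j
  · rfl
  · exact G.vertexAt_alongEnd (e, i, false)

theorem boundaryAt_end {E : Type*} [DecidableEq E] (G : RibbonGraph E) (H : Finset E)
    {e : E} (he : e ∈ H) (i j : Bool) :
    G.boundaryAt H (e, i, j) = G.boundaryAt H (e, false, j) := by
  cases i
  · rfl
  · simpa [boundaryStep, he, Corner.alongSide] using
      G.boundaryAt_boundaryStep H (e, false, j)

theorem eulerGenus_add_bc {E : Type*} [Finite E] [DecidableEq E] (G : RibbonGraph E)
    (H : Finset E) :
    G.eulerGenus H + G.bc H = (G.spanning H).numComponents + (G.spanning H).nullity := by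
  classical
  have := Fintype.ofFinite E
  have := Fintype.ofFinite G.Vertex
  have := Fintype.ofFinite (G.BoundaryComponent H)
  let F := G.spanning H
  have : Fintype F.vertexSet := Fintype.ofFinite _
  let v : Corner E → F.vertexSet := fun d => ⟨G.vertexAt d, trivial⟩
  let M : Matrix H F.vertexSet (ZMod 2) := Matrix.of fun e x =>
    ((if v (e, false, false) = x then 1 else 0) + (if v (e, true, false) = x then 1 else 0))
  let N : Matrix H (G.BoundaryComponent H) (ZMod 2) := Matrix.of fun e b =>
    ((if G.boundaryAt H (e, false, false) = b then 1 else 0) +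
      (if G.boundaryAt H (e, false, true) = b then 1 else 0))
  have hM : F.vertexSet.ncard ≤ M.rank + F.numComponents := by
    refine F.card_le_rank_add (fun e : H => v (e, false, false)) (fun e => v (e, true, false)) ?_
    rintro ⟨x, hx⟩ ⟨y, hy⟩ ⟨e, he, i, hxi, hyi⟩
    refine ⟨⟨e, he⟩, ?_⟩
    cases i
    · exact Or.inl ⟨Subtype.ext hxi, Subtype.ext hyi⟩
    · exact Or.inr ⟨Subtype.ext hxi, Subtype.ext hyi⟩
  let p : G.BoundaryComponent H → F.components := fun b => ⟨F.componentOf (match b with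
    | Sum.inl q => G.vertexAt q.out
    | Sum.inr i => Sum.inr i), _, trivial, rfl⟩
  have hN : Fintype.card (G.BoundaryComponent H) ≤ N.rank + Nat.card F.components := by
    refine matrix_card_le_rank_add N p ?_
    intro g hg
    have hg1 : ∀ e ∈ H, g (G.boundaryAt H (e, false, false)) =
        g (G.boundaryAt H (e, false, true)) := by
      intro e he
      have := congrFun hg ⟨e, he⟩
      simp only [N, Matrix.mulVec, dotProduct, Matrix.of_apply, add_mul, Finset.sum_add_distrib,
        ite_mul, one_mul, zero_mul, Finset.sum_ite_eq, Finset.mem_univ, if_true,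
        Pi.zero_apply] at this
      exact CharTwo.add_eq_zero.1 this
    have hg2 : ∀ d : Corner E, g (G.boundaryAt H d.alongEnd) = g (G.boundaryAt H d) := by
      rintro ⟨e, i, j⟩
      by_cases he : e ∈ H
      · simp only [Corner.alongEnd]
        rw [G.boundaryAt_end H he i, G.boundaryAt_end H he i]
        cases j
        · exact (hg1 e he).symm
        · exact hg1 e he
      · have := G.boundaryAt_boundaryStep H (e, i, j)
        rw [boundaryStep, if_neg he] at this
        rw [this]
    let h : G.Vertex → ZMod 2 := fun x => match x with
      | Sum.inl q => Quot.lift (fun d => g (G.boundaryAt H d)) (by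
          rintro d d' (rfl | rfl)
          · rw [boundaryAt_arc]
          · rw [hg2]) q
      | Sum.inr i => g (Sum.inr i)
    have hh : ∀ d, h (G.vertexAt d) = g (G.boundaryAt H d) := fun d => rfl
    have hadj : ∀ x y, F.Adj x y → h x = h y := by
      rintro x y ⟨e, he, i, rfl, rfl⟩
      have he' : e ∈ H := he
      rw [hh, hh, G.boundaryAt_end H he', G.boundaryAt_end H he' (!i)]
    have hR : ∀ x y, Relation.ReflTransGen F.Adj x y → h x = h y := by
      intro x y hxy
      induction hxy with
      | refl => rfl
      | tail _ hbc ih => exact ih.trans (hadj _ _ hbc)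
    have hgh : ∀ b : G.BoundaryComponent H, g b = h (match b with
        | Sum.inl q => G.vertexAt q.out
        | Sum.inr i => Sum.inr i) := by
      rintro (q | i)
      · rw [hh, boundaryAt, Quot.out_eq]
      · rfl
    intro b b' hb
    rw [hgh, hgh]
    exact hR _ _ (F.componentOf_eq_iff.1 (congrArg Subtype.val hb))
  have hMN : M.transpose * N = 0 := by
    ext x b
    let φ : Corner E → ZMod 2 := fun d =>
      (if v d = x then 1 else 0) * (if G.boundaryAt H d = b then 1 else 0)
    have hv : ∀ e i j, v (e, i, j) = v (e, i, false) := fun e i j =>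
      Subtype.ext (G.vertexAt_side e i j)
    have e1 : (M.transpose * N) x b = ∑ e : H, ∑ i : Bool, ∑ j : Bool, φ (e, i, j) := by
      rw [Matrix.mul_apply]
      refine Finset.sum_congr rfl fun e _ => ?_
      simp only [φ, Fintype.sum_bool]
      rw [hv _ _ true, hv _ _ true, G.boundaryAt_end H e.2 true, G.boundaryAt_end H e.2 true]
      simp only [M, N, Matrix.transpose_apply, Matrix.of_apply]
      ring
    have e2 : ∑ e : H, ∑ i : Bool, ∑ j : Bool, φ (e, i, j) =
        ∑ d : Corner E, if d.1 ∈ H then φ d else 0 := by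
      rw [Fintype.sum_prod_type, Finset.sum_coe_sort H
        (fun e => ∑ i : Bool, ∑ j : Bool, φ (e, i, j)), ← Finset.sum_filter_of_ne
        (p := fun e => e ∈ H) (s := Finset.univ) (f := fun e => ∑ y : Bool × Bool,
          if e ∈ H then φ (e, y) else 0)]
      · rw [Finset.filter_univ_mem]
        refine Finset.sum_congr rfl fun e he => ?_
        simp only [he, if_true, Fintype.sum_prod_type]
      · intro e _ h
        by_contra he
        simp [he] at h
    have e3 : ∑ d : Corner E, φ d = 0 := by
      refine Finset.sum_ninvolution G.arc (fun d => ?_) (fun d _ => G.arc_ne d)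
        (fun d => Finset.mem_univ _) G.arc_arc
      have : v (G.arc d) = v d := Subtype.ext (G.vertexAt_arc d)
      simp only [φ, this, boundaryAt_arc]
      exact CharTwo.add_self_eq_zero _
    have e4 : ∑ d : Corner E, (if d.1 ∈ H then 0 else φ d) = 0 := by
      refine Finset.sum_ninvolution Corner.alongEnd (fun d => ?_) (fun d _ h => ?_)
        (fun d => Finset.mem_univ _) (fun d => by simp [Corner.alongEnd])
      · by_cases hd : d.1 ∈ H
        · simp [Corner.alongEnd, hd]
        · have h1 : v d.alongEnd = v d := Subtype.ext (G.vertexAt_alongEnd d)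
          have h2 := G.boundaryAt_boundaryStep H d
          rw [boundaryStep, if_neg hd] at h2
          have h3 : d.alongEnd.1 = d.1 := rfl
          simp only [φ, h1, h2, h3, hd, if_false]
          exact CharTwo.add_self_eq_zero _
      · have := congrArg (fun d : Corner E => d.2.2) h
        simp [Corner.alongEnd] at this
    have e5 : ∑ d : Corner E, φ d = (∑ d : Corner E, if d.1 ∈ H then φ d else 0) +
        ∑ d : Corner E, (if d.1 ∈ H then 0 else φ d) := by
      rw [← Finset.sum_add_distrib]
      exact Finset.sum_congr rfl fun d _ => by split_ifs <;> simp
    rw [e3, e4, add_zero] at e5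
    rw [e1, e2, ← e5]
    rfl
  have hrank := Matrix.rank_add_rank_le_card_of_mul_eq_zero hMN
  rw [Matrix.rank_transpose, Fintype.card_coe] at hrank
  have hnull := F.nullity_add_card
  have hE : F.edgeSet.ncard = H.card := by
    have : F.edgeSet = (H : Set E) := Set.univ_inter _
    rw [this, Set.ncard_coe_finset]
  rw [Nat.card_coe_set_eq, ← Nat.card_eq_fintype_card] at hN
  have hN' : G.bc H ≤ N.rank + F.numComponents := hN
  have : G.eulerGenus H = F.numComponents + F.nullity - G.bc H := rfl
  change _ = F.numComponents + F.nullity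
  omega

/-- `G` is connected (in particular, it has a vertex). -/
def IsConnected {E : Type*} (G : RibbonGraph E) : Prop := G.toGraph.numComponents = 1

/-- The Bollobás–Riordan polynomial
`BR_G(X, Y, Z) = ∑_F X ^ (c(F) - c(G)) * Y ^ n(F) * Z ^ (c(F) + n(F) - bc(F))`,
the sum being over all spanning ribbon subgraphs of `G`. -/
noncomputable def bollobasRiordan {E : Type*} [Fintype E] [DecidableEq E] (G : RibbonGraph E) :
    MvPolynomial (Fin 3) ℤ :=
  ∑ H : Finset E,
    MvPolynomial.X 0 ^ ((G.spanning H).numComponents - G.toGraph.numComponents) *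
      MvPolynomial.X 1 ^ (G.spanning H).nullity *
      MvPolynomial.X 2 ^ G.eulerGenus H

/-! ### Partial duals and activities -/

/-- Exchange of the roles of ends and sides on the ribbons in `H`. -/
def swapOn {E : Type*} [DecidableEq E] (H : Finset E) (d : Corner E) : Corner E :=
  if d.1 ∈ H then (d.1, d.2.2, d.2.1) else d

theorem swapOn_swapOn {E : Type*} [DecidableEq E] (H : Finset E) (d : Corner E) :
    swapOn H (swapOn H d) = d := by
  by_cases h : d.1 ∈ H <;> simp [swapOn, h]

/-- The partial dual `G^H`: discs are glued to the boundary components of `F_H`, and the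
interiors of the vertices of `G` are removed. The arcs remain, and so do the ribbons, but the
ribbons in `H` are now attached to the new vertex discs along their former sides. (An isolated
vertex disc is replaced by the disc glued to its boundary.) -/
def partialDual {E : Type*} [DecidableEq E] (G : RibbonGraph E) (H : Finset E) :
    RibbonGraph E where
  arc d := swapOn H (G.arc (swapOn H d))
  arc_arc d := by simp [swapOn_swapOn, G.arc_arc]
  arc_ne d h := G.arc_ne (swapOn H d) (by
    have := congrArg (swapOn H) h
    simpa [swapOn_swapOn] using this)
  isolated := G.isolated

/-- One step in the traversal of the boundary of a vertex disc: from the corner `d`, run along the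
end of the ribbon at `d`, then along the next arc up to the next ribbon end. -/
def travel {E : Type*} (G : RibbonGraph E) (d : Corner E) : Corner E := G.arc d.alongEnd

/-- The edges `e` and `f` are linked: in one turn around the boundary of a vertex, the ribbons
`e` and `f` are met alternately, in the order `e`, `f`, `e`, `f`. -/
def Links {E : Type*} (G : RibbonGraph E) (e f : E) : Prop :=
  e ≠ f ∧ ∃ d : Corner E, ∃ i j k : ℕ, 0 < i ∧ i < j ∧ j < k ∧
    k < Function.minimalPeriod G.travel d ∧ d.1 = e ∧ (G.travel^[i] d).1 = f ∧
    (G.travel^[j] d).1 = e ∧ (G.travel^[k] d).1 = f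

/-- `e` is an orientable loop: if in the traversal of the boundary of its vertex one reaches one end
of the ribbon `e` on the side `false` (and leaves it on the side `true`), then in
the same traversal one reaches the other end on the side `true` (and leaves it on the side
`false`). So the ribbon and the vertex disc form an annulus; if the other end is reached on the side
`false`, they form a Möbius band. -/
def IsOrientableLoop {E : Type*} (G : RibbonGraph E) (e : E) : Prop :=
  ∃ k : ℕ, G.travel^[k] (e, false, false) = (e, true, true)

/-- The spanning ribbon subgraph with edge set `Q` is a quasi-tree. -/
def IsQuasiTree {E : Type*} [DecidableEq E] (G : RibbonGraph E) (Q : Finset E) : Prop :=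
  G.bc Q = 1

open Classical in
/-- The set of (the edge sets of) the quasi-trees of `G`. -/
noncomputable def quasiTrees {E : Type*} [Fintype E] [DecidableEq E] (G : RibbonGraph E) :
    Finset (Finset E) :=
  Finset.univ.filter G.IsQuasiTree

/-- `e` is live with respect to `Q`: in the partial dual `G^Q` it does not link any lower edge. -/
def IsLive {E : Type*} [LinearOrder E] (G : RibbonGraph E) (Q : Finset E) (e : E) : Prop :=
  ∀ f, f < e → ¬ (G.partialDual Q).Links e f

/-- `e` is orientable with respect to `Q`: it is an orientable loop of the partial dual `G^Q`. -/
def IsOrientableEdge {E : Type*} [DecidableEq E] (G : RibbonGraph E) (Q : Finset E) (e : E) :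
    Prop :=
  (G.partialDual Q).IsOrientableLoop e

open Classical in
/-- The internally dead edges. -/
noncomputable def internalDead {E : Type*} [LinearOrder E] (G : RibbonGraph E) (Q : Finset E) :
    Finset E :=
  Q.filter (fun e => ¬ G.IsLive Q e)

open Classical in
/-- The internally live orientable edges. -/
noncomputable def internalLiveOrientable {E : Type*} [LinearOrder E] (G : RibbonGraph E)
    (Q : Finset E) : Finset E :=
  Q.filter (fun e => G.IsLive Q e ∧ G.IsOrientableEdge Q e)

open Classical in
/-- The internally live nonorientable edges. -/
noncomputable def internalLiveNonorientable {E : Type*} [LinearOrder E] (G : RibbonGraph E)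
    (Q : Finset E) : Finset E :=
  Q.filter (fun e => G.IsLive Q e ∧ ¬ G.IsOrientableEdge Q e)

open Classical in
/-- The externally live orientable edges. -/
noncomputable def externalLiveOrientable {E : Type*} [Fintype E] [LinearOrder E]
    (G : RibbonGraph E) (Q : Finset E) : Finset E :=
  Finset.univ.filter (fun e => e ∉ Q ∧ G.IsLive Q e ∧ G.IsOrientableEdge Q e)

/-- `VI(Q)`, the internal edges which are dead, or live and nonorientable. -/
noncomputable def VI {E : Type*} [LinearOrder E] (G : RibbonGraph E) (Q : Finset E) : Finset E :=
  G.internalDead Q ∪ G.internalLiveNonorientable Q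

/-- The graph `G_Q`: its vertices are the connected components of `F_{VI(Q)}` and its edges are the
internally live orientable edges. -/
noncomputable def quasiTreeGraph {E : Type*} [LinearOrder E] (G : RibbonGraph E) (Q : Finset E) :
    Graph (Set G.Vertex) E :=
  (G.spanning (G.internalLiveOrientable Q)).map (G.spanning (G.VI Q)).componentOf

end RibbonGraph

/-! ### Boundary components, and how their number changes when one ribbon is added -/

namespace RibbonGraph

variable {E : Type*}

/-! The spanning ribbon subgraphs are partitioned into intervals, one for each quasi-tree `Q`: the
interval of `Q` consists of the `F` that agree with `Q` off its live orientable edges. Thus `F =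
VI(Q) ∪ A ∪ B` with `A ⊆ I_o(Q)` and `B ⊆ E_o(Q)`, and the theorem follows by summing over each
interval.

The partition has a purely set-theoretic source (`Finset.existsUnique_agree_off_active`): for a
nonempty family of sets, call `e` active at a member `Q` if the elements of `Q` above `e` decide,
within the family, whether `e` belongs to `Q`; then every set agrees with exactly one member off the
active elements of that member. For the family of quasi-trees, active means live and orientable
(`isActiveIn_quasiTrees_iff`). Indeed `bc_partialDual` says that `Q Δ S` is a quasi-tree of `G` iff
`S` is one of the one-vertex ribbon graph `G^Q`. If the highest edge of `S` is an orientable loop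
linked to no other edge of `S`, it separates its two sides (`boundaryAt_ne_of_not_links`), so `S`
has at least two boundary components. Conversely, a nonorientable loop alone, or an orientable loop
together with an edge linked to it, has exactly one.

On an interval the exponents are explicit. Adding live orientable edges to `G^Q` in increasing order
creates one boundary component each time, whence `bc(F) = 1 + |I_o \ A| + |B|`. The edges of `B` do
not change the number of components of `F`, and contracting `VI(Q)` gives `c(F) = c(G_Q|A)`. Hence
`n(F) = n(F_VI) + n(G_Q|A) + |B|`, and `c + n - bc` exceeds its value at `F_VI` by `2 n(G_Q|A)`. The
sum over `B` is then `(1 + Y)^|E_o|`, and the sum over `A` is the Tutte polynomial at `(X, YZ²)`. -/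

theorem alongEnd_alongEnd (d : Corner E) : d.alongEnd.alongEnd = d := by
  simp [Corner.alongEnd]

theorem alongSide_alongSide (d : Corner E) : d.alongSide.alongSide = d := by
  simp [Corner.alongSide]

theorem alongEnd_ne (d : Corner E) : d.alongEnd ≠ d := fun h => by
  have := congrArg (fun d : Corner E => d.2.2) h
  simp [Corner.alongEnd] at this

theorem alongSide_ne (d : Corner E) : d.alongSide ≠ d := fun h => by
  have := congrArg (fun d : Corner E => d.2.1) h
  simp [Corner.alongSide] at this

variable [DecidableEq E]

theorem boundaryStep_fst (H : Finset E) (d : Corner E) : (boundaryStep H d).1 = d.1 := by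
  unfold boundaryStep; split_ifs <;> rfl

theorem boundaryStep_boundaryStep (H : Finset E) (d : Corner E) :
    boundaryStep H (boundaryStep H d) = d := by
  by_cases h : d.1 ∈ H
  · have : d.alongSide.1 ∈ H := h
    simp [boundaryStep, h, this, alongSide_alongSide]
  · have : d.alongEnd.1 ∉ H := h
    simp [boundaryStep, h, this, alongEnd_alongEnd]

theorem boundaryStep_ne (H : Finset E) (d : Corner E) : boundaryStep H d ≠ d := by
  unfold boundaryStep; split_ifs
  · exact alongSide_ne d
  · exact alongEnd_ne d

/-- A set of corners closed under arcs and boundary steps is a union of boundary components. -/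
theorem boundaryAt_induction (G : RibbonGraph E) (H : Finset E) {P : Corner E → Prop}
    (harc : ∀ d, P d → P (G.arc d)) (hstep : ∀ d, P d → P (boundaryStep H d))
    {d d' : Corner E} (h : G.boundaryAt H d = G.boundaryAt H d') (hd : P d) : P d' := by
  have hP : ∀ a b : Corner E, b = G.arc a ∨ b = boundaryStep H a → P a = P b := by
    rintro a b (rfl | rfl)
    · exact propext ⟨harc a, fun h => by simpa [G.arc_arc] using harc _ h⟩
    · exact propext ⟨hstep a, fun h => by
        simpa [boundaryStep_boundaryStep] using hstep _ h⟩
  exact (congrArg (Quot.lift P hP) (Sum.inl_injective h)).mp hd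

/-- The corners on the boundary component of `F_H` through the corner `d`. -/
def boundaryClass (G : RibbonGraph E) (H : Finset E) (d : Corner E) : Set (Corner E) :=
  {d' | G.boundaryAt H d' = G.boundaryAt H d}

theorem boundaryClass_eq_iff (G : RibbonGraph E) (H : Finset E) {d d' : Corner E} :
    G.boundaryClass H d = G.boundaryClass H d' ↔ G.boundaryAt H d = G.boundaryAt H d' := by
  constructor
  · intro h
    have : d ∈ G.boundaryClass H d' := h ▸ (rfl : d ∈ G.boundaryClass H d)
    exact this
  · intro h
    ext x
    simp [boundaryClass, h]

/-- The boundary components for different `H` are elements of different quotient types. As sets of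
corners they can be compared. -/
theorem bc_eq_ncard_add (G : RibbonGraph E) [Finite E] (H : Finset E) :
    G.bc H = (Set.range (G.boundaryClass H)).ncard + G.isolated := by
  unfold bc BoundaryComponent
  rw [Nat.card_sum, Nat.card_fin]
  congr 1
  let f : Quot (fun d d' : Corner E => d' = G.arc d ∨ d' = boundaryStep H d) → Set (Corner E) :=
    Quot.lift (G.boundaryClass H) (by
      rintro a b (rfl | rfl)
      · rw [boundaryClass_eq_iff, boundaryAt_arc]
      · rw [boundaryClass_eq_iff, boundaryAt_boundaryStep])
  have hf : Function.Injective f := by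
    rintro ⟨a⟩ ⟨b⟩ h
    exact Sum.inl_injective ((G.boundaryClass_eq_iff H).1 h)
  have hr : Set.range (G.boundaryClass H) = Set.range f := by
    ext x
    constructor
    · rintro ⟨d, rfl⟩; exact ⟨Quot.mk _ d, rfl⟩
    · rintro ⟨⟨d⟩, rfl⟩; exact ⟨d, rfl⟩
  rw [hr, ← Nat.card_coe_set_eq, Nat.card_range_of_injective hf]

/-- A boundary component which does not meet the ribbon `e` does not change when `e` is added
or removed. -/
theorem boundaryClass_congr (G : RibbonGraph E) {H K : Finset E} {e : E}
    (hHK : ∀ f, f ≠ e → (f ∈ H ↔ f ∈ K)) {d : Corner E}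
    (hd : ∀ x ∈ G.boundaryClass H d, x.1 ≠ e) :
    G.boundaryClass H d = G.boundaryClass K d := by
  have hstep : ∀ x : Corner E, x.1 ≠ e → boundaryStep H x = boundaryStep K x := by
    intro x hx
    simp [boundaryStep, hHK _ hx]
  have h1 : G.boundaryClass K d ⊆ G.boundaryClass H d := by
    intro x hx
    refine G.boundaryAt_induction K (P := fun x => x ∈ G.boundaryClass H d) ?_ ?_ hx.symm rfl
    · intro y hy
      exact (G.boundaryAt_arc H y).trans hy
    · intro y hy
      rw [← hstep y (hd y hy)]
      exact (G.boundaryAt_boundaryStep H y).trans hy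
  refine subset_antisymm ?_ h1
  intro x hx
  refine G.boundaryAt_induction H (P := fun x => x ∈ G.boundaryClass K d) ?_ ?_ hx.symm rfl
  · intro y hy
    exact (G.boundaryAt_arc K y).trans hy
  · intro y hy
    rw [hstep y (hd y (h1 hy))]
    exact (G.boundaryAt_boundaryStep K y).trans hy

/-- The boundary components which meet the ribbon `e`. -/
def boundaryMeeting (G : RibbonGraph E) (H : Finset E) (e : E) : Set (Set (Corner E)) :=
  {C ∈ Set.range (G.boundaryClass H) | ∃ x ∈ C, x.1 = e}

/-- The boundary components which do not meet the ribbon `e`. -/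
def boundaryAvoiding (G : RibbonGraph E) (H : Finset E) (e : E) : Set (Set (Corner E)) :=
  {C ∈ Set.range (G.boundaryClass H) | ∀ x ∈ C, x.1 ≠ e}

theorem bc_eq_meeting_add_avoiding (G : RibbonGraph E) [Finite E] (H : Finset E) (e : E) :
    G.bc H = (G.boundaryMeeting H e).ncard + (G.boundaryAvoiding H e).ncard + G.isolated := by
  rw [bc_eq_ncard_add, ← Set.ncard_union_eq _ (Set.toFinite _) (Set.toFinite _)]
  · congr 2
    ext C
    constructor
    · intro hC
      by_cases h : ∃ x ∈ C, x.1 = e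
      · exact Or.inl ⟨hC, h⟩
      · push Not at h
        exact Or.inr ⟨hC, h⟩
    · rintro (h | h) <;> exact h.1
  · rw [Set.disjoint_left]
    rintro C ⟨-, x, hx, hxe⟩ ⟨-, h⟩
    exact h x hx hxe

theorem boundaryAvoiding_congr (G : RibbonGraph E) {H K : Finset E} {e : E}
    (hHK : ∀ f, f ≠ e → (f ∈ H ↔ f ∈ K)) :
    G.boundaryAvoiding H e = G.boundaryAvoiding K e := by
  have key : ∀ H K : Finset E, (∀ f, f ≠ e → (f ∈ H ↔ f ∈ K)) →
      G.boundaryAvoiding H e ⊆ G.boundaryAvoiding K e := by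
    rintro H K h _ ⟨⟨d, rfl⟩, hd⟩
    exact ⟨⟨d, (G.boundaryClass_congr h hd).symm⟩, hd⟩
  exact subset_antisymm (key H K hHK) (key K H fun f hf => (hHK f hf).symm)

theorem boundaryMeeting_eq (G : RibbonGraph E) (H : Finset E) (e : E) :
    G.boundaryMeeting H e = {C | ∃ i j, C = G.boundaryClass H (e, i, j)} := by
  ext C
  constructor
  · rintro ⟨⟨d, rfl⟩, ⟨f, i, j⟩, hx, rfl⟩
    exact ⟨i, j, ((G.boundaryClass_eq_iff H).2 hx).symm⟩
  · rintro ⟨i, j, rfl⟩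
    exact ⟨⟨_, rfl⟩, (e, i, j), rfl, rfl⟩

theorem boundaryAt_alongEnd_of_notMem (G : RibbonGraph E) {H : Finset E} {d : Corner E}
    (h : d.1 ∉ H) : G.boundaryAt H d.alongEnd = G.boundaryAt H d := by
  have := G.boundaryAt_boundaryStep H d
  rwa [boundaryStep, if_neg h] at this

theorem boundaryAt_alongSide_of_mem (G : RibbonGraph E) {H : Finset E} {d : Corner E}
    (h : d.1 ∈ H) : G.boundaryAt H d.alongSide = G.boundaryAt H d := by
  have := G.boundaryAt_boundaryStep H d
  rwa [boundaryStep, if_pos h] at this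

theorem boundaryAt_side_of_notMem (G : RibbonGraph E) {H : Finset E} {e : E}
    (h : e ∉ H) (i j : Bool) : G.boundaryAt H (e, i, j) = G.boundaryAt H (e, i, false) := by
  cases j
  · rfl
  · exact G.boundaryAt_alongEnd_of_notMem (d := (e, i, false)) h

open Classical in
theorem ncard_boundaryMeeting_of_notMem (G : RibbonGraph E) {H : Finset E} {e : E} (he : e ∉ H) :
    (G.boundaryMeeting H e).ncard =
      if G.boundaryAt H (e, false, false) = G.boundaryAt H (e, true, false) then 1 else 2 := by
  have : G.boundaryMeeting H e =
      {G.boundaryClass H (e, false, false), G.boundaryClass H (e, true, false)} := by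
    rw [boundaryMeeting_eq]
    ext C
    have h : ∀ i j, G.boundaryClass H (e, i, j) = G.boundaryClass H (e, i, false) := fun i j =>
      (G.boundaryClass_eq_iff H).2 (G.boundaryAt_side_of_notMem he i j)
    simp [h]
  rw [this]
  split_ifs with h
  · rw [(G.boundaryClass_eq_iff H).2 h]
    simp
  · exact Set.ncard_pair fun h' => h ((G.boundaryClass_eq_iff H).1 h')

open Classical in
theorem ncard_boundaryMeeting_of_mem (G : RibbonGraph E) {H : Finset E} {e : E} (he : e ∈ H) :
    (G.boundaryMeeting H e).ncard =
      if G.boundaryAt H (e, false, false) = G.boundaryAt H (e, false, true) then 1 else 2 := by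
  have : G.boundaryMeeting H e =
      {G.boundaryClass H (e, false, false), G.boundaryClass H (e, false, true)} := by
    rw [boundaryMeeting_eq]
    ext C
    have h : ∀ i j, G.boundaryClass H (e, i, j) = G.boundaryClass H (e, false, j) := fun i j =>
      (G.boundaryClass_eq_iff H).2 (G.boundaryAt_end H he i j)
    simp [h]
  rw [this]
  split_ifs with h
  · rw [(G.boundaryClass_eq_iff H).2 h]
    simp
  · exact Set.ncard_pair fun h' => h ((G.boundaryClass_eq_iff H).1 h')

/-- The ends of a ribbon `e ∉ F_H` lie on one boundary component of `F_H`, or the sides of `e` lie on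
one boundary component of `F_H ∪ e`. -/
theorem boundaryAt_eq_or_boundaryAt_insert_eq (G : RibbonGraph E) [Finite E] {H : Finset E} {e : E}
    (he : e ∉ H) :
    G.boundaryAt H (e, false, false) = G.boundaryAt H (e, true, false) ∨
      G.boundaryAt (insert e H) (e, false, false) =
        G.boundaryAt (insert e H) (e, false, true) := by
  classical
  have := Fintype.ofFinite E
  by_contra hcon
  push Not at hcon
  obtain ⟨h1, h2⟩ := hcon
  -- The relation `r` generates the pieces common to the boundaries of `F_H` and of `F_H ∪ e`: both
  -- are cut open at the four corners of `e`. A piece through one corner of `e` must end at another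
  -- one, which a parity count on the corners of the piece shows.
  let r : Corner E → Corner E → Prop := fun d d' =>
    d' = G.arc d ∨ (d.1 ≠ e ∧ d' = boundaryStep H d)
  have hins : ∀ d : Corner E, d.1 ≠ e → boundaryStep (insert e H) d = boundaryStep H d := by
    intro d hd
    simp [boundaryStep, hd]
  have hH : ∀ d d', Quot.mk r d = Quot.mk r d' → G.boundaryAt H d = G.boundaryAt H d' := by
    intro d d' h
    refine congrArg (Quot.lift (G.boundaryAt H) ?_) h
    rintro a b (rfl | ⟨-, rfl⟩)
    · rw [boundaryAt_arc]
    · rw [boundaryAt_boundaryStep]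
  have hK : ∀ d d', Quot.mk r d = Quot.mk r d' →
      G.boundaryAt (insert e H) d = G.boundaryAt (insert e H) d' := by
    intro d d' h
    refine congrArg (Quot.lift (G.boundaryAt (insert e H)) ?_) h
    rintro a b (rfl | ⟨ha, rfl⟩)
    · rw [boundaryAt_arc]
    · rw [← hins a ha, boundaryAt_boundaryStep]
  let p : Corner E := (e, false, false)
  let K : Finset (Corner E) := Finset.univ.filter fun d => Quot.mk r d = Quot.mk r p
  have hp : p ∈ K := by simp [K]
  have harc : ∀ d ∈ K, G.arc d ∈ K := by
    intro d hd
    simp only [K, Finset.mem_filter, Finset.mem_univ, true_and] at hd ⊢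
    exact (Quot.sound (r := r) (Or.inl rfl)).symm.trans hd
  have hstep : ∀ d ∈ K, d.1 ≠ e → boundaryStep H d ∈ K := by
    intro d hd hde
    simp only [K, Finset.mem_filter, Finset.mem_univ, true_and] at hd ⊢
    exact (Quot.sound (r := r) (Or.inr ⟨hde, rfl⟩)).symm.trans hd
  -- The corner on the other side of the same end would put the sides of `e` on one component of
  -- `F_H ∪ e`; a corner at the other end would put the ends on one component of `F_H`.
  have honly : ∀ d ∈ K, d.1 = e → d = p := by
    rintro ⟨f, i, j⟩ hd rfl
    simp only [K, Finset.mem_filter, Finset.mem_univ, true_and] at hd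
    have a1 := hH _ _ hd
    have a2 := hK _ _ hd
    cases i
    · cases j
      · rfl
      · exact absurd a2.symm h2
    · rw [G.boundaryAt_side_of_notMem he] at a1
      exact absurd a1.symm h1
  -- Arcs pair off all of `K`, while boundary steps pair off `K` without `p`.
  have s1 : ∑ d ∈ K, (1 : ZMod 2) = 0 :=
    Finset.sum_involution (fun d _ => G.arc d) (fun _ _ => CharTwo.add_self_eq_zero _)
      (fun d _ _ => G.arc_ne d) (fun d hd => harc d hd) (fun d _ => G.arc_arc d)
  have s2 : ∑ d ∈ K.erase p, (1 : ZMod 2) = 0 := by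
    have hne : ∀ d ∈ K.erase p, d.1 ≠ e := by
      intro d hd h
      rw [Finset.mem_erase] at hd
      exact hd.1 (honly d hd.2 h)
    refine Finset.sum_involution (fun d _ => boundaryStep H d)
      (fun _ _ => CharTwo.add_self_eq_zero _)
      (fun d _ _ => boundaryStep_ne H d) (fun d hd => ?_)
      (fun d _ => boundaryStep_boundaryStep H d)
    refine Finset.mem_erase.2 ⟨fun h => hne d hd ?_, hstep d (Finset.mem_erase.1 hd).2 (hne d hd)⟩
    rw [← boundaryStep_fst H d, h]
  rw [← Finset.add_sum_erase K _ hp, s2, add_zero] at s1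
  exact one_ne_zero s1

/-- The parity argument puts the ends of `e` on one component of `F_H`. This component is replaced
by two, and those that avoid `e` remain. -/
theorem bc_insert_of_sides_ne (G : RibbonGraph E) [Finite E] {H : Finset E} {e : E} (he : e ∉ H)
    (h : G.boundaryAt (insert e H) (e, false, false) ≠
      G.boundaryAt (insert e H) (e, false, true)) :
    G.bc (insert e H) = G.bc H + 1 := by
  have h' := (G.boundaryAt_eq_or_boundaryAt_insert_eq he).resolve_right h
  rw [G.bc_eq_meeting_add_avoiding H e, G.bc_eq_meeting_add_avoiding (insert e H) e,
    G.ncard_boundaryMeeting_of_notMem he,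
    G.ncard_boundaryMeeting_of_mem (Finset.mem_insert_self e H), if_neg h, if_pos h',
    G.boundaryAvoiding_congr (H := insert e H) (K := H) (fun f hf => by simp [hf])]
  omega

theorem bc_insert_of_ends_ne (G : RibbonGraph E) [Finite E] {H : Finset E} {e : E} (he : e ∉ H)
    (h : G.boundaryAt H (e, false, false) ≠ G.boundaryAt H (e, true, false)) :
    G.bc (insert e H) + 1 = G.bc H := by
  have h' := (G.boundaryAt_eq_or_boundaryAt_insert_eq he).resolve_left h
  rw [G.bc_eq_meeting_add_avoiding H e, G.bc_eq_meeting_add_avoiding (insert e H) e,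
    G.ncard_boundaryMeeting_of_notMem he,
    G.ncard_boundaryMeeting_of_mem (Finset.mem_insert_self e H), if_neg h, if_pos h',
    G.boundaryAvoiding_congr (H := insert e H) (K := H) (fun f hf => by simp [hf])]
  omega

theorem bc_insert_of_eq (G : RibbonGraph E) [Finite E] {H : Finset E} {e : E} (he : e ∉ H)
    (h : G.boundaryAt H (e, false, false) = G.boundaryAt H (e, true, false))
    (h' : G.boundaryAt (insert e H) (e, false, false) =
      G.boundaryAt (insert e H) (e, false, true)) :
    G.bc (insert e H) = G.bc H := by
  rw [G.bc_eq_meeting_add_avoiding H e, G.bc_eq_meeting_add_avoiding (insert e H) e,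
    G.ncard_boundaryMeeting_of_notMem he,
    G.ncard_boundaryMeeting_of_mem (Finset.mem_insert_self e H), if_pos h, if_pos h',
    G.boundaryAvoiding_congr (H := insert e H) (K := H) (fun f hf => by simp [hf])]

/-- A ribbon between two different boundary components would merge them. -/
theorem boundaryAt_eq_of_bc_lt_insert (G : RibbonGraph E) [Finite E] {H : Finset E} {e : E}
    (he : e ∉ H) (h : G.bc H < G.bc (insert e H)) :
    G.boundaryAt H (e, false, false) = G.boundaryAt H (e, true, false) := by
  by_contra hne
  have := G.bc_insert_of_ends_ne he hne
  omega

end RibbonGraph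

/-! ### Partial duals, traversal of a vertex, and loops at a single vertex -/

namespace RibbonGraph

variable {E : Type*}

/-- Exchanging ends and sides on `Q` turns the boundary steps for `S` into those for the symmetric
difference, and carries the arcs of the dual to those of `G`. -/
theorem bc_partialDual [DecidableEq E] (G : RibbonGraph E) (Q S : Finset E) :
    (G.partialDual Q).bc S = G.bc (symmDiff Q S) := by
  have hstep : ∀ d : Corner E,
      swapOn Q (boundaryStep S d) = boundaryStep (symmDiff Q S) (swapOn Q d) := by
    rintro ⟨e, i, j⟩
    by_cases h1 : e ∈ Q <;> by_cases h2 : e ∈ S <;>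
      simp [swapOn, boundaryStep, Corner.alongSide, Corner.alongEnd, Finset.mem_symmDiff, h1, h2]
  have hinj : Function.Injective (swapOn Q) :=
    Function.LeftInverse.injective (swapOn_swapOn Q)
  refine Nat.card_congr (Equiv.sumCongr (Quot.congr
    ⟨swapOn Q, swapOn Q, swapOn_swapOn Q, swapOn_swapOn Q⟩ fun a b => ?_) (Equiv.refl _))
  simp only [Equiv.coe_fn_mk]
  rw [← hstep, hinj.eq_iff]
  refine or_congr ?_ Iff.rfl
  change b = swapOn Q (G.arc (swapOn Q a)) ↔ _
  rw [← hinj.eq_iff, swapOn_swapOn]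

/-- The map `alongEnd` reverses the direction of traversal. -/
theorem travel_alongEnd_travel (G : RibbonGraph E) (d : Corner E) :
    G.travel (G.travel d).alongEnd = d.alongEnd := by
  simp [travel, alongEnd_alongEnd, G.arc_arc]

theorem travel_injective (G : RibbonGraph E) : Function.Injective G.travel := by
  intro a b h
  have := congrArg (fun d => (G.travel d.alongEnd).alongEnd) h
  simpa [travel_alongEnd_travel, alongEnd_alongEnd] using this

theorem travel_iterate_alongEnd (G : RibbonGraph E) (k : ℕ) (d : Corner E) :
    G.travel^[k] (G.travel^[k] d).alongEnd = d.alongEnd := by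
  induction k with
  | zero => rfl
  | succ k ih =>
    rw [Function.iterate_succ_apply, Function.iterate_succ_apply', travel_alongEnd_travel, ih]

/-- The two directions of traversal of the boundary of a vertex are distinct. -/
theorem travel_iterate_ne_alongEnd (G : RibbonGraph E) (k : ℕ) (d : Corner E) :
    G.travel^[k] d ≠ d.alongEnd := by
  induction k using Nat.twoStepInduction generalizing d with
  | zero => exact (alongEnd_ne d).symm
  | one => exact G.arc_ne _
  | more k ih _ =>
    -- Moving one step inwards from both extremities of the walk shortens it by two. In the end
    -- `alongEnd` or `arc` would have a fixed point.
    intro h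
    rw [Function.iterate_succ_apply', Function.iterate_succ_apply,
      ← travel_alongEnd_travel] at h
    exact ih _ (G.travel_injective h)

theorem travel_iterate_ne_alongEnd_travel_iterate (G : RibbonGraph E) (k m : ℕ) (d : Corner E) :
    G.travel^[k] d ≠ (G.travel^[m] d).alongEnd := by
  intro h
  have := congrArg (G.travel^[m]) h
  rw [travel_iterate_alongEnd, ← Function.iterate_add_apply] at this
  exact G.travel_iterate_ne_alongEnd _ _ this

theorem minimalPeriod_travel_pos [Finite E] (G : RibbonGraph E) (d : Corner E) :
    0 < Function.minimalPeriod G.travel d :=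
  Function.minimalPeriod_pos_of_mem_periodicPts (G.travel_injective.mem_periodicPts d)

theorem exists_travel_eq [Finite E] (G : RibbonGraph E) (d : Corner E) (k : ℕ) :
    ∃ m, G.travel (G.travel^[m] d) = G.travel^[k] d := by
  cases k with
  | zero =>
    refine ⟨Function.minimalPeriod G.travel d - 1, ?_⟩
    rw [← Function.iterate_succ_apply' G.travel, Nat.succ_eq_add_one,
      Nat.sub_add_cancel (G.minimalPeriod_travel_pos d)]
    exact Function.iterate_minimalPeriod
  | succ k => exact ⟨k, (Function.iterate_succ_apply' _ _ _).symm⟩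

theorem eq_of_fst_eq {c d : Corner E} (h : c.1 = d.1) :
    c = d ∨ c = d.alongEnd ∨ c = d.alongSide ∨ c = d.alongSide.alongEnd := by
  obtain ⟨e, i, j⟩ := c
  obtain ⟨f, k, l⟩ := d
  obtain rfl : e = f := h
  cases i <;> cases j <;> cases k <;> cases l <;> simp [Corner.alongEnd, Corner.alongSide]

/-- The criterion for orientable loops at an arbitrary corner. -/
theorem IsOrientableLoop.exists_travel_iterate [Finite E] {G : RibbonGraph E} {e : E}
    (h : G.IsOrientableLoop e) {d : Corner E} (hd : d.1 = e) :
    ∃ k < Function.minimalPeriod G.travel d, G.travel^[k] d = d.alongSide.alongEnd := by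
  suffices ∃ k, G.travel^[k] d = d.alongSide.alongEnd by
    obtain ⟨k, hk⟩ := this
    refine ⟨k % Function.minimalPeriod G.travel d,
      Nat.mod_lt _ (G.minimalPeriod_travel_pos d), ?_⟩
    rwa [Function.iterate_mod_minimalPeriod_eq]
  have back : ∀ (x y : Corner E) (k : ℕ), G.travel^[k] x = y → ∃ m, G.travel^[m] y = x := by
    rintro x _ k rfl
    have hN := G.minimalPeriod_travel_pos x
    -- Going back `k` steps amounts to completing `k` full periods.
    refine ⟨Function.minimalPeriod G.travel x * k - k, ?_⟩
    rw [← Function.iterate_add_apply, Nat.sub_add_cancel (Nat.le_mul_of_pos_left k hN)]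
    exact (Function.isPeriodicPt_minimalPeriod G.travel x).mul_const k
  obtain ⟨k, hk⟩ := h
  have hk' := G.travel_iterate_alongEnd k (e, false, false)
  rw [hk] at hk'
  obtain ⟨f, i, j⟩ := d
  obtain rfl : f = e := hd
  cases i <;> cases j
  · exact ⟨k, hk⟩
  · exact back _ _ k hk'
  · exact ⟨k, hk'⟩
  · exact back _ _ k hk

variable [DecidableEq E]

/-- If there is only one vertex, then the traversal of its boundary reaches all ends of ribbons. -/
theorem exists_travel_iterate_eq [Finite E] (G : RibbonGraph E) (h1 : G.bc ∅ = 1)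
    (d c : Corner E) : ∃ k < Function.minimalPeriod G.travel d,
      G.travel^[k] d = c ∨ G.travel^[k] d = c.alongEnd := by
  have : Subsingleton (G.BoundaryComponent ∅) := (Nat.card_eq_one_iff_unique.1 h1).1
  have key : ∃ k, G.travel^[k] d = c ∨ G.travel^[k] d = c.alongEnd := by
    -- `F_∅` consists of the vertex discs alone, so its boundary components are the vertices of `G`.
    refine G.boundaryAt_induction ∅
      (P := fun c => ∃ k, G.travel^[k] d = c ∨ G.travel^[k] d = c.alongEnd)
      ?_ ?_ (Subsingleton.elim (G.boundaryAt ∅ d) (G.boundaryAt ∅ c)) ⟨0, Or.inl rfl⟩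
    · rintro c ⟨k, h | h⟩
      · obtain ⟨m, hm⟩ := G.exists_travel_eq d k
        refine ⟨m, Or.inr (G.travel_injective ?_)⟩
        rw [hm, h, travel, alongEnd_alongEnd, G.arc_arc]
      · refine ⟨k + 1, Or.inl ?_⟩
        rw [Function.iterate_succ_apply', h, travel, alongEnd_alongEnd]
    · rintro c ⟨k, h⟩
      refine ⟨k, ?_⟩
      have : boundaryStep ∅ c = c.alongEnd := by simp [boundaryStep]
      rw [this, alongEnd_alongEnd]
      exact h.symm
  obtain ⟨k, hk⟩ := key
  refine ⟨k % Function.minimalPeriod G.travel d,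
    Nat.mod_lt _ (G.minimalPeriod_travel_pos d), ?_⟩
  rwa [Function.iterate_mod_minimalPeriod_eq]

/-- If `e` is an orientable loop at the only vertex and is not linked to the other ribbons of `F_S`,
then its two sides lie on different boundary components of `F_S`. -/
theorem boundaryAt_ne_of_not_links [Finite E] (G : RibbonGraph E) (h1 : G.bc ∅ = 1) {S : Finset E}
    {e : E} (heS : e ∈ S) (he : G.IsOrientableLoop e) (hl : ∀ g ∈ S, ¬ G.Links e g)
    {d : Corner E} (hd : d.1 = e) :
    G.boundaryAt S d ≠ G.boundaryAt S d.alongEnd := by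
  obtain ⟨k, hkN, hk⟩ := he.exists_travel_iterate hd
  set N := Function.minimalPeriod G.travel d with hN
  have hinj : ∀ {m n : ℕ}, m < N → n < N → G.travel^[m] d = G.travel^[n] d → m = n :=
    fun hm hn h => Function.iterate_injOn_Iio_minimalPeriod hm hn h
  have hk0 : 0 < k := by
    rcases Nat.eq_zero_or_pos k with rfl | h
    · have := congrArg (fun d : Corner E => d.2.1) hk
      simp [Corner.alongSide, Corner.alongEnd] at this
    · exact h
  -- `P` is the segment of the vertex boundary from the corner where the first end of `e` is left to
  -- the corner where the other end is reached. One side of `e` joins its two extremities. Any other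
  -- ribbon of `S` has both ends in it or none, since otherwise it would be linked with `e`. So `P`
  -- is a union of boundary components that contains `d.alongEnd` but not `d`.
  let P : Corner E → Prop := fun c =>
    ∃ m < k, c = (G.travel^[m] d).alongEnd ∨ c = G.travel^[m + 1] d
  have hPd : ¬ P d := by
    rintro ⟨m, hm, h | h⟩
    · exact G.travel_iterate_ne_alongEnd_travel_iterate 0 m d h
    · have := hinj (m := 0) (by omega) (by omega) h
      omega
  have hPd' : ¬ P d.alongSide := by
    have h0 : d.alongSide = (G.travel^[k] d).alongEnd := by rw [hk, alongEnd_alongEnd]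
    rw [h0]
    rintro ⟨m, hm, h | h⟩
    · have h2 := congrArg Corner.alongEnd h
      rw [alongEnd_alongEnd, alongEnd_alongEnd] at h2
      have := hinj hkN (hm.trans hkN) h2
      omega
    · exact G.travel_iterate_ne_alongEnd_travel_iterate _ _ d h.symm
  intro hcon
  refine hPd (G.boundaryAt_induction S (P := P) ?_ ?_ hcon.symm ⟨0, hk0, Or.inl rfl⟩)
  · rintro c ⟨m, hm, h⟩
    refine ⟨m, hm, ?_⟩
    rw [Function.iterate_succ_apply'] at h ⊢
    rcases h with rfl | rfl
    · exact Or.inr rfl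
    · exact Or.inl (G.arc_arc _)
  · intro c hPc
    by_cases hce : c.1 = e
    · rw [boundaryStep, if_pos (hce ▸ heS)]
      rcases eq_of_fst_eq (hce.trans hd.symm) with rfl | rfl | rfl | rfl
      · exact absurd hPc hPd
      · refine ⟨k - 1, by omega, Or.inr ?_⟩
        rw [Nat.sub_add_cancel hk0, hk]
        simp [Corner.alongSide, Corner.alongEnd]
      · exact absurd hPc hPd'
      · refine ⟨0, hk0, Or.inl ?_⟩
        simp [Corner.alongSide, Corner.alongEnd]
    -- Away from `e`, the two forms of corners in `P` are the two corners of the end met at one time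
    -- `m`, strictly between the two ends of `e`.
    · have hm : ∃ m, 0 < m ∧ m < k ∧ (c = G.travel^[m] d ∨ c = (G.travel^[m] d).alongEnd) := by
        obtain ⟨m, hm, rfl | rfl⟩ := hPc
        · refine ⟨m, ?_, hm, Or.inr rfl⟩
          rcases Nat.eq_zero_or_pos m with rfl | h
          · exact absurd hd hce
          · exact h
        · refine ⟨m + 1, by omega, ?_, Or.inl rfl⟩
          rcases Nat.lt_or_ge (m + 1) k with h | h
          · exact h
          · obtain rfl : m + 1 = k := by omega
            rw [hk] at hce
            exact absurd hd hce
      obtain ⟨m, hm0, hmk, hcm⟩ := hm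
      have hin : ∀ n x, 0 < n → n < k → (x = G.travel^[n] d ∨ x = (G.travel^[n] d).alongEnd) →
          P x := by
        rintro n x hn0 hnk (rfl | rfl)
        · exact ⟨n - 1, by omega, Or.inr (by rw [Nat.sub_add_cancel hn0])⟩
        · exact ⟨n, hnk, Or.inl rfl⟩
      have hmc : (G.travel^[m] d).1 = c.1 := by rcases hcm with rfl | rfl <;> rfl
      by_cases hcS : c.1 ∈ S
      · rw [boundaryStep, if_pos hcS]
        obtain ⟨n, hnN, hn⟩ := G.exists_travel_iterate_eq h1 d c.alongSide
        have hnc : (G.travel^[n] d).1 = c.1 := by rcases hn with h | h <;> rw [h] <;> rfl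
        have hn0 : n ≠ 0 := by
          rintro rfl
          exact hce (hnc.symm.trans hd)
        have hnk : n ≠ k := by
          rintro rfl
          rw [hk] at hnc
          exact hce (hnc.symm.trans hd)
        rcases Nat.lt_or_gt_of_ne hnk with hlt | hgt
        · refine hin n _ (by omega) hlt ?_
          rcases hn with h | h
          · exact Or.inl h.symm
          · exact Or.inr (by rw [h, alongEnd_alongEnd])
        -- At the times `0 < m < k < n` the traversal meets `e`, `c.1`, `e`, `c.1`, so the two
        -- ribbons are linked.
        · refine absurd ⟨fun h => hce h.symm, d, m, k, n, hm0, hmk, hgt, hnN, hd, hmc, ?_, hnc⟩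
            (hl c.1 hcS)
          rw [hk]
          exact hd
      · rw [boundaryStep, if_neg hcS]
        refine hin m _ hm0 hmk ?_
        rcases hcm with rfl | rfl
        · exact Or.inr rfl
        · exact Or.inl (alongEnd_alongEnd _)

/-- Between two ends of ribbons of `F_S`, the boundary of `F_S` follows that of the vertices. -/
theorem boundaryAt_travel_iterate (G : RibbonGraph E) {S : Finset E} {d : Corner E} {m n : ℕ}
    (hmn : m ≤ n) (h : ∀ l, m ≤ l → l < n → (G.travel^[l] d).1 ∉ S) :
    G.boundaryAt S (G.travel^[n] d) = G.boundaryAt S (G.travel^[m] d) := by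
  induction n, hmn using Nat.le_induction with
  | base => rfl
  | succ n hmn ih =>
    rw [Function.iterate_succ_apply', travel, boundaryAt_arc,
      G.boundaryAt_alongEnd_of_notMem (h n hmn (Nat.lt_succ_self n))]
    exact ih fun l h1 h2 => h l h1 (by omega)

/-- The vertex disc and the ribbon form a Möbius band. -/
theorem bc_singleton_of_not_isOrientableLoop [Finite E] (G : RibbonGraph E) (h1 : G.bc ∅ = 1)
    {e : E} (he : ¬ G.IsOrientableLoop e) : G.bc {e} = 1 := by
  have : Subsingleton (G.BoundaryComponent ∅) := (Nat.card_eq_one_iff_unique.1 h1).1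
  rw [← h1, ← LawfulSingleton.insert_empty_eq]
  refine G.bc_insert_of_eq (Finset.notMem_empty e) (Subsingleton.elim _ _) ?_
  rw [LawfulSingleton.insert_empty_eq]
  let d : Corner E := (e, false, false)
  obtain ⟨k, hkN, hk⟩ := G.exists_travel_iterate_eq h1 d d.alongSide
  have hk : G.travel^[k] d = d.alongSide := by
    rcases hk with h | h
    · exact h
    · exact absurd ⟨k, h⟩ he
  have hk0 : 0 < k := by
    rcases Nat.eq_zero_or_pos k with rfl | h
    · exact absurd hk.symm (alongSide_ne d)
    · exact h
  -- After `d` the traversal meets `e` first at `d.alongSide`. So the boundary of `F_{e}` runs from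
  -- `d.alongEnd` to `d.alongSide`, and then along the ribbon to `d`, which lies on its other side.
  have hwalk : G.boundaryAt {e} (G.travel^[k] d) = G.boundaryAt {e} (G.travel^[1] d) := by
    refine G.boundaryAt_travel_iterate hk0 fun l hl hlk hle => ?_
    rcases eq_of_fst_eq (d := d) (Finset.mem_singleton.1 hle) with h | h | h | h
    · have := Function.iterate_injOn_Iio_minimalPeriod (f := G.travel) (x := d)
        (hlk.trans hkN : l ∈ Set.Iio _) (hk0.trans hkN : 0 ∈ Set.Iio _) h
      omega
    · exact G.travel_iterate_ne_alongEnd _ _ h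
    · have := Function.iterate_injOn_Iio_minimalPeriod (f := G.travel) (x := d)
        (hlk.trans hkN : l ∈ Set.Iio _) (hkN : k ∈ Set.Iio _) (h.trans hk.symm)
      omega
    · exact he ⟨l, h⟩
  have h2 : G.boundaryAt {e} (G.travel^[1] d) = G.boundaryAt {e} d.alongEnd :=
    G.boundaryAt_arc _ _
  rw [hk, h2, G.boundaryAt_alongSide_of_mem (d := d) (Finset.mem_singleton_self e)] at hwalk
  exact hwalk

theorem bc_singleton_of_isOrientableLoop [Finite E] (G : RibbonGraph E) (h1 : G.bc ∅ = 1)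
    {e : E} (he : G.IsOrientableLoop e) : G.bc {e} = 2 := by
  have hne := G.boundaryAt_ne_of_not_links h1 (Finset.mem_singleton_self e) he
    (fun g hg h => h.1 (Finset.mem_singleton.1 hg).symm) (d := (e, false, false)) rfl
  rw [← LawfulSingleton.insert_empty_eq] at hne ⊢
  rw [G.bc_insert_of_sides_ne (Finset.notMem_empty e) hne, h1]

/-- The loop `e` and the disc form an annulus. Being linked to `e`, the ribbon `f` joins its two
boundary circles and so merges them. -/
theorem bc_pair_of_links [Finite E] (G : RibbonGraph E) (h1 : G.bc ∅ = 1)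
    {e f : E} (he : G.IsOrientableLoop e) (hl : G.Links e f) : G.bc {f, e} = 1 := by
  obtain ⟨hef, d, i, j, k, hi, hij, hjk, hkN, hd, hdi, hdj, hdk⟩ := hl
  have hfe : f ∉ ({e} : Finset E) := fun h => hef (Finset.mem_singleton.1 h).symm
  suffices G.boundaryAt {e} (f, false, false) ≠ G.boundaryAt {e} (f, true, false) by
    have := G.bc_insert_of_ends_ne hfe this
    rw [G.bc_singleton_of_isOrientableLoop h1 he] at this
    omega
  intro hff
  have hall : ∀ c : Corner E, c.1 = f → G.boundaryAt {e} c = G.boundaryAt {e} (f, false, false) := by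
    rintro ⟨g, a, b⟩ hg
    obtain rfl : g = f := hg
    rw [G.boundaryAt_side_of_notMem hfe]
    cases a
    · rfl
    · exact hff.symm
  have hinj : ∀ {m n : ℕ}, m < Function.minimalPeriod G.travel d →
      n < Function.minimalPeriod G.travel d → G.travel^[m] d = G.travel^[n] d → m = n :=
    fun hm hn h => Function.iterate_injOn_Iio_minimalPeriod hm hn h
  obtain ⟨k', hk'N, hk'⟩ := he.exists_travel_iterate hd
  have honly : ∀ m, 0 < m → m < Function.minimalPeriod G.travel d → (G.travel^[m] d).1 = e →
      m = k' := by
    intro m hm hmN hme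
    rcases eq_of_fst_eq (hme.trans hd.symm) with h | h | h | h
    · have := hinj hmN (hm.trans hmN) (n := 0) h
      omega
    · exact absurd h (G.travel_iterate_ne_alongEnd _ _)
    · refine absurd ?_ (G.travel_iterate_ne_alongEnd_travel_iterate m k' d)
      rw [hk', alongEnd_alongEnd, h]
    · exact hinj hmN hk'N (h.trans hk'.symm)
  obtain rfl := honly j (by omega) (by omega) hdj
  -- The end of `f` met at time `i` lies on the circle through the segment before time `j`, and the
  -- one met at time `k` on the circle through the rest of the turn. If the circles coincide, then
  -- so do the components of the two sides of `e`.
  have w1 : G.boundaryAt {e} (G.travel^[j] d) = G.boundaryAt {e} (G.travel^[i] d) := by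
    refine G.boundaryAt_travel_iterate hij.le fun l hl hlj hle => ?_
    have := honly l (by omega) (by omega) (Finset.mem_singleton.1 hle)
    omega
  have w2 : G.boundaryAt {e} d = G.boundaryAt {e} (G.travel^[k] d) := by
    have := G.boundaryAt_travel_iterate (S := {e}) (d := d) hkN.le fun l hl hlN hle => by
      have := honly l (by omega) (by omega) (Finset.mem_singleton.1 hle)
      omega
    rwa [Function.iterate_minimalPeriod] at this
  refine G.boundaryAt_ne_of_not_links h1 (Finset.mem_singleton_self e) he
    (fun g hg h => h.1 (Finset.mem_singleton.1 hg).symm) hd ?_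
  have hs : d.alongSide.alongEnd = d.alongEnd.alongSide := rfl
  rw [w2, hall _ hdk, ← hall _ hdi, ← w1, hk', hs,
    G.boundaryAt_alongSide_of_mem (d := d.alongEnd) (Finset.mem_singleton.2 hd)]

end RibbonGraph

/-! ### Activities in an arbitrary family of sets -/

/-- `e` is active with respect to the member `Q` of the family `𝓠` of sets: all members of `𝓠` that
agree with `Q` above `e` agree with `Q` at `e`. -/
def Finset.IsActiveIn {E : Type*} [LinearOrder E] (𝓠 : Finset (Finset E)) (Q : Finset E)
    (e : E) : Prop :=
  ∀ Q' ∈ 𝓠, (∀ f, e < f → (f ∈ Q ↔ f ∈ Q')) → (e ∈ Q ↔ e ∈ Q')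

/-- A nonempty family of sets partitions the power set into the intervals given by activities. -/
theorem Finset.existsUnique_agree_off_active {E : Type*} [Fintype E] [LinearOrder E]
    {𝓠 : Finset (Finset E)} (h𝓠 : 𝓠.Nonempty) (H : Finset E) :
    ∃! Q, Q ∈ 𝓠 ∧ ∀ e, ¬ IsActiveIn 𝓠 Q e → (e ∈ Q ↔ e ∈ H) := by
  classical
  have htop : ∀ S T : Finset E, S ≠ T →
      ∃ e, ¬ (e ∈ S ↔ e ∈ T) ∧ ∀ f, e < f → (f ∈ S ↔ f ∈ T) := by
    intro S T hST
    have hne : (Finset.univ.filter fun e => ¬ (e ∈ S ↔ e ∈ T)).Nonempty := by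
      by_contra h
      rw [Finset.not_nonempty_iff_eq_empty, Finset.filter_eq_empty_iff] at h
      exact hST (Finset.ext fun e => not_not.1 (h (Finset.mem_univ e)))
    refine ⟨Finset.max' _ hne, (Finset.mem_filter.1 (Finset.max'_mem _ hne)).2, fun f hf => ?_⟩
    by_contra h
    exact absurd (Finset.le_max' _ f (by simp [h])) (not_le.2 hf)
  let bad : Finset E → Finset E := fun Q =>
    Finset.univ.filter fun e => ¬ IsActiveIn 𝓠 Q e ∧ ¬ (e ∈ Q ↔ e ∈ H)
  -- The chosen member has its highest inactive disagreement with `H` as low as possible; the value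
  -- is `⊥` if there is none.
  obtain ⟨Q, hQ, hmin⟩ := Finset.exists_min_image 𝓠 (fun Q => (bad Q).max) h𝓠
  have hQH : ∀ e, ¬ IsActiveIn 𝓠 Q e → (e ∈ Q ↔ e ∈ H) := by
    intro e he
    by_contra hne
    have hbad : (bad Q).Nonempty := ⟨e, by simp [bad, he, hne]⟩
    obtain ⟨m, hm⟩ := Finset.max_of_nonempty hbad
    have hmb := Finset.mem_of_max hm
    simp only [bad, Finset.mem_filter, Finset.mem_univ, true_and] at hmb
    obtain ⟨hma, hmH⟩ := hmb
    unfold IsActiveIn at hma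
    push Not at hma
    obtain ⟨Q', hQ', hagree, hm'⟩ := hma
    have hlt : (bad Q').max < (bad Q).max := by
      rw [hm, Finset.max_eq_sup_coe, Finset.sup_lt_iff (WithBot.bot_lt_coe m)]
      intro g hg
      simp only [bad, Finset.mem_filter, Finset.mem_univ, true_and] at hg
      obtain ⟨hga, hgH⟩ := hg
      rw [WithBot.coe_lt_coe]
      by_contra hmg
      -- At `m` itself `Q'` agrees with `H`, because it differs there from `Q`. Above `m` the sets
      -- `Q` and `Q'` coincide, and activity at `g` depends only on the part of the member from `g`
      -- upwards.
      rcases (not_lt.1 hmg).eq_or_lt with rfl | hmg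
      · tauto
      · have hgQ : ¬ IsActiveIn 𝓠 Q g := by
          intro h
          refine hga fun R hR hRQ => ?_
          rw [← hagree g hmg]
          exact h R hR fun f hf => (hagree f (hmg.trans hf)).trans (hRQ f hf)
        have : g ∈ bad Q := by
          simp only [bad, Finset.mem_filter, Finset.mem_univ, true_and]
          exact ⟨hgQ, by rwa [hagree g hmg]⟩
        exact absurd (Finset.le_max_of_eq this hm) (not_le.2 hmg)
    exact absurd (hmin Q' hQ') (not_le.2 hlt)
  refine ⟨Q, ⟨hQ, hQH⟩, ?_⟩
  rintro Q' ⟨hQ', hQH'⟩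
  by_contra hne
  -- At the highest element where they differ, each member witnesses that this element is inactive
  -- for the other, so both would agree with `H` there.
  obtain ⟨e, he, hf⟩ := htop Q' Q hne
  exact he ((hQH' e fun h => he (h Q hQ hf)).trans
    (hQH e fun h => he (h Q' hQ' fun f h => (hf f h).symm).symm).symm)

/-! ### Quasi-trees: activity, existence and the partition into intervals -/

namespace RibbonGraph

variable {E : Type*}

theorem bc_partialDual_empty [DecidableEq E] (G : RibbonGraph E) (Q : Finset E) :
    (G.partialDual Q).bc ∅ = G.bc Q := by
  rw [bc_partialDual]
  exact congrArg _ (symmDiff_bot Q)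

/-- The sides of the highest ribbon of `S`, if it is live and orientable. -/
theorem boundaryAt_partialDual_ne [Finite E] [LinearOrder E] (G : RibbonGraph E) {Q S : Finset E}
    (hQ : G.IsQuasiTree Q) {e : E} (heS : e ∈ S) (hmax : ∀ f ∈ S, f ≤ e) (hl : G.IsLive Q e)
    (ho : G.IsOrientableEdge Q e) :
    (G.partialDual Q).boundaryAt S (e, false, false) ≠
      (G.partialDual Q).boundaryAt S (e, false, true) := by
  refine (G.partialDual Q).boundaryAt_ne_of_not_links ((G.bc_partialDual_empty Q).trans hQ)
    heS ho ?_ (d := (e, false, false)) rfl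
  intro g hg h
  exact hl g ((hmax g hg).lt_of_ne h.1.symm) h

theorem mem_quasiTrees [Fintype E] [DecidableEq E] (G : RibbonGraph E) {Q : Finset E} :
    Q ∈ G.quasiTrees ↔ G.IsQuasiTree Q := by
  simp [quasiTrees]

/-- The live orientable edges are those at which a quasi-tree is determined by its higher edges. -/
theorem isActiveIn_quasiTrees_iff [Fintype E] [LinearOrder E] (G : RibbonGraph E) {Q : Finset E}
    (hQ : G.IsQuasiTree Q) (e : E) :
    Finset.IsActiveIn G.quasiTrees Q e ↔ G.IsLive Q e ∧ G.IsOrientableEdge Q e := by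
  have h1 : (G.partialDual Q).bc ∅ = 1 := (G.bc_partialDual_empty Q).trans hQ
  constructor
  · intro h
    -- Such an `S` would give the quasi-tree `Q Δ S`, which agrees with `Q` above `e` and differs
    -- from it at `e`.
    have hno : ∀ S : Finset E, (G.partialDual Q).bc S = 1 → e ∈ S → ¬ ∀ f ∈ S, f ≤ e := by
      intro S hS heS hmax
      rw [bc_partialDual] at hS
      have := h _ (G.mem_quasiTrees.2 hS) fun f hf => by
        have : f ∉ S := fun hfS => absurd (hmax f hfS) (not_le.2 hf)
        simp [Finset.mem_symmDiff, this]
      simp only [Finset.mem_symmDiff, heS, not_true, and_false, true_and, false_or] at this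
      tauto
    have ho : G.IsOrientableEdge Q e := by
      by_contra ho
      exact hno _ ((G.partialDual Q).bc_singleton_of_not_isOrientableLoop h1 ho)
        (Finset.mem_singleton_self e) fun f hf => (Finset.mem_singleton.1 hf).le
    refine ⟨fun f hf hl => ?_, ho⟩
    refine hno _ ((G.partialDual Q).bc_pair_of_links h1 ho hl) (by simp) fun g hg => ?_
    rcases Finset.mem_insert.1 hg with rfl | hg
    · exact hf.le
    · exact (Finset.mem_singleton.1 hg).le
  · rintro ⟨hl, ho⟩ Q' hQ' hagree
    by_contra hne
    have heS : e ∈ symmDiff Q Q' := by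
      rw [Finset.mem_symmDiff]
      tauto
    refine G.boundaryAt_partialDual_ne hQ heS (fun f hf => ?_) hl ho ?_
    · by_contra hfe
      have := hagree f (not_le.1 hfe)
      rw [Finset.mem_symmDiff] at hf
      tauto
    · have : (G.partialDual Q).bc (symmDiff Q Q') = 1 := by
        rw [bc_partialDual, symmDiff_symmDiff_cancel_left]
        exact G.mem_quasiTrees.1 hQ'
      have := (Nat.card_eq_one_iff_unique.1 this).1
      exact Subsingleton.elim _ _

theorem reflTransGen_of_isConnected (G : RibbonGraph E) (hG : G.IsConnected) (x y : G.Vertex) :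
    Relation.ReflTransGen G.toGraph.Adj x y := by
  obtain ⟨C, hC⟩ := Set.ncard_eq_one.1 hG
  have h : ∀ z, G.toGraph.componentOf z = C := fun z => by
    have : G.toGraph.componentOf z ∈ G.toGraph.components := ⟨z, trivial, rfl⟩
    rw [hC] at this
    exact this
  exact G.toGraph.componentOf_eq_iff.1 ((h x).trans (h y).symm)

theorem nonempty_vertex_of_isConnected (G : RibbonGraph E) (hG : G.IsConnected) :
    Nonempty G.Vertex := by
  obtain ⟨C, hC⟩ := Set.ncard_eq_one.1 hG
  have : C ∈ G.toGraph.components := hC ▸ Set.mem_singleton C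
  obtain ⟨x, -⟩ := this
  exact ⟨x⟩

theorem quasiTrees_nonempty [Fintype E] [DecidableEq E] (G : RibbonGraph E) (hG : G.IsConnected) :
    G.quasiTrees.Nonempty := by
  -- At the minimum of `bc`, all corners of a ribbon lie on one boundary component; otherwise
  -- removing or adding the ribbon would merge two. Boundary components then depend only on the
  -- vertices they pass through, and connectedness leaves just one.
  obtain ⟨H, -, hmin⟩ := Finset.exists_min_image (Finset.univ : Finset (Finset E)) G.bc
    Finset.univ_nonempty
  refine ⟨H, G.mem_quasiTrees.2 ?_⟩
  have hcorner : ∀ e i j, G.boundaryAt H (e, i, j) = G.boundaryAt H (e, false, false) := by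
    intro e i j
    by_cases he : e ∈ H
    · rw [G.boundaryAt_end H he]
      by_contra hne
      have hj : G.boundaryAt H (e, false, false) ≠ G.boundaryAt H (e, false, true) := by
        cases j
        · exact absurd rfl hne
        · exact Ne.symm hne
      have h := G.bc_insert_of_sides_ne (H := H.erase e) (Finset.notMem_erase e H)
        (by rwa [Finset.insert_erase he])
      rw [Finset.insert_erase he] at h
      have := hmin (H.erase e) (Finset.mem_univ _)
      omega
    · rw [G.boundaryAt_side_of_notMem he]
      by_contra hne
      have hi : G.boundaryAt H (e, false, false) ≠ G.boundaryAt H (e, true, false) := by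
        cases i
        · exact absurd rfl hne
        · exact Ne.symm hne
      have h := G.bc_insert_of_ends_ne he hi
      have := hmin (insert e H) (Finset.mem_univ _)
      omega
  let φ : G.Vertex → G.BoundaryComponent H := fun x => match x with
    | Sum.inl q => Quot.lift (G.boundaryAt H) (by
        rintro ⟨e, i, j⟩ d' (rfl | rfl)
        · rw [boundaryAt_arc]
        · exact (hcorner e _ _).trans (hcorner e _ _).symm) q
    | Sum.inr i => Sum.inr i
  have hφ : Function.Surjective φ := by
    rintro (q | i)
    · induction q using Quot.ind with
      | mk d => exact ⟨G.vertexAt d, rfl⟩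
    · exact ⟨Sum.inr i, rfl⟩
  have hadj : ∀ x y, G.toGraph.Adj x y → φ x = φ y := by
    rintro x y ⟨e, i, rfl, rfl⟩
    exact (hcorner e i false).trans (hcorner e (!i) false).symm
  have hconst : ∀ x y, φ x = φ y := by
    intro x y
    have h := G.reflTransGen_of_isConnected hG x y
    induction h with
    | refl => rfl
    | tail _ hbc ih => exact ih.trans (hadj _ _ hbc)
  obtain ⟨x⟩ := G.nonempty_vertex_of_isConnected hG
  refine Nat.card_eq_one_iff_unique.2 ⟨⟨fun a b => ?_⟩, ⟨φ x⟩⟩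
  obtain ⟨x, rfl⟩ := hφ a
  obtain ⟨y, rfl⟩ := hφ b
  exact hconst x y

/-- Each spanning ribbon subgraph agrees with exactly one quasi-tree off the live orientable edges
of the latter. -/
theorem existsUnique_quasiTree [Fintype E] [LinearOrder E] (G : RibbonGraph E)
    (hG : G.IsConnected) (H : Finset E) :
    ∃! Q, Q ∈ G.quasiTrees ∧
      ∀ e, ¬ (G.IsLive Q e ∧ G.IsOrientableEdge Q e) → (e ∈ Q ↔ e ∈ H) := by
  have key : ∀ Q, (Q ∈ G.quasiTrees ∧
      ∀ e, ¬ Finset.IsActiveIn G.quasiTrees Q e → (e ∈ Q ↔ e ∈ H)) ↔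
      (Q ∈ G.quasiTrees ∧
        ∀ e, ¬ (G.IsLive Q e ∧ G.IsOrientableEdge Q e) → (e ∈ Q ↔ e ∈ H)) := by
    intro Q
    refine and_congr_right fun hQ => forall_congr' fun e => ?_
    rw [G.isActiveIn_quasiTrees_iff (G.mem_quasiTrees.1 hQ)]
  have := Finset.existsUnique_agree_off_active (G.quasiTrees_nonempty hG) H
  simpa only [key] using this

/-- Adding the live orientable edges of a quasi-tree to the partial dual. -/
theorem bc_partialDual_of_live_orientable [Finite E] [LinearOrder E] (G : RibbonGraph E)
    {Q : Finset E} (hQ : G.IsQuasiTree Q) (S : Finset E)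
    (hS : ∀ e ∈ S, G.IsLive Q e ∧ G.IsOrientableEdge Q e) :
    (G.partialDual Q).bc S = 1 + S.card := by
  -- In increasing order each new edge is the highest one so far. Being live, it is linked to none
  -- of the earlier ones.
  induction S using Finset.induction_on_max with
  | empty => exact (G.bc_partialDual_empty Q).trans hQ
  | insert e S he ih =>
    have heS : e ∉ S := fun h => lt_irrefl e (he e h)
    obtain ⟨hl, ho⟩ := hS e (Finset.mem_insert_self e S)
    rw [(G.partialDual Q).bc_insert_of_sides_ne heS, ih fun f hf =>
      hS f (Finset.mem_insert_of_mem hf), Finset.card_insert_of_notMem heS, add_assoc]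
    refine G.boundaryAt_partialDual_ne hQ (Finset.mem_insert_self e S) (fun f hf => ?_) hl ho
    rcases Finset.mem_insert.1 hf with rfl | hf
    · exact le_rfl
    · exact (he f hf).le

end RibbonGraph

/-! ### Components of multigraphs under contraction -/

/-- Two maps with the same fibres have equally many values. This reduces each comparison of numbers
of components to one of connectedness relations, even between graphs with different vertex types. -/
theorem Set.ncard_image_eq_of_iff {ι α β : Type*} {f : ι → α} {g : ι → β} {s : Set ι}
    (h : ∀ x y, f x = f y ↔ g x = g y) : (f '' s).ncard = (g '' s).ncard := by
  refine Set.ncard_congr (fun a ha => g ha.choose) ?_ ?_ ?_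
  · exact fun a ha => ⟨_, ha.choose_spec.1, rfl⟩
  · intro a b ha hb hab
    rw [← ha.choose_spec.2, ← hb.choose_spec.2]
    exact (h _ _).2 hab
  · rintro _ ⟨x, hx, rfl⟩
    have hfx : f x ∈ f '' s := ⟨x, hx, rfl⟩
    exact ⟨f x, hfx, (h _ _).1 hfx.choose_spec.2⟩

namespace Graph

variable {α β : Type*}

theorem reflTransGen_symm (G : Graph α β) {x y : α} (h : Relation.ReflTransGen G.Adj x y) :
    Relation.ReflTransGen G.Adj y x :=
  G.componentOf_eq_iff.1 (G.componentOf_eq h).symm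

theorem reflTransGen_restrict_mono (G : Graph α β) {K L : Set β} (hKL : K ⊆ L) {x y : α}
    (h : Relation.ReflTransGen (G.restrict K).Adj x y) :
    Relation.ReflTransGen (G.restrict L).Adj x y :=
  Relation.ReflTransGen.mono (fun _ _ ⟨e, he⟩ => ⟨e, hKL he.1, he.2⟩) _ _ h

/-- Contraction of the edges in `K` does not change the connectedness relation. -/
theorem reflTransGen_contract_iff (G : Graph α β) {K L A : Set β} (hA : A ⊆ L) {x y : α} :
    Relation.ReflTransGen (((G.restrict L).map (G.restrict K).componentOf).restrict A).Adj
      ((G.restrict K).componentOf x) ((G.restrict K).componentOf y) ↔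
      Relation.ReflTransGen (G.restrict (K ∪ A)).Adj x y := by
  have hK : ∀ u v, (G.restrict K).componentOf u = (G.restrict K).componentOf v →
      Relation.ReflTransGen (G.restrict (K ∪ A)).Adj u v := fun u v h =>
    G.reflTransGen_restrict_mono Set.subset_union_left ((G.restrict K).componentOf_eq_iff.1 h)
  constructor
  · intro h
    suffices ∀ X, Relation.ReflTransGen
        (((G.restrict L).map (G.restrict K).componentOf).restrict A).Adj
        ((G.restrict K).componentOf x) X → ∀ v, (G.restrict K).componentOf v = X →
        Relation.ReflTransGen (G.restrict (K ∪ A)).Adj x v from this _ h y rfl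
    intro X hX
    induction hX with
    | refl => exact fun v hv => hK _ _ hv.symm
    | tail _ hbc ih =>
      obtain ⟨e, heA, u, w, hl, hu, hw⟩ := hbc
      intro v hv
      exact ((ih u hu).tail ⟨e, Or.inr heA, hl.2⟩).trans (hK _ _ (hw.trans hv.symm))
  · intro h
    induction h with
    | refl => exact Relation.ReflTransGen.refl
    | @tail b c _ hbc ih =>
      obtain ⟨e, he | he, hl⟩ := hbc
      · have : (G.restrict K).componentOf b = (G.restrict K).componentOf c :=
          (G.restrict K).componentOf_eq (.single ⟨e, he, hl⟩)
        rwa [← this]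
      · exact ih.tail ⟨e, he, b, c, ⟨hA he, hl⟩, rfl, rfl⟩

theorem numComponents_contract (G : Graph α β) {K L A : Set β} (hA : A ⊆ L) :
    (((G.restrict L).map (G.restrict K).componentOf).restrict A).numComponents =
      (G.restrict (K ∪ A)).numComponents := by
  have : (((G.restrict L).map (G.restrict K).componentOf).restrict A).components =
      (fun x => (((G.restrict L).map (G.restrict K).componentOf).restrict A).componentOf
        ((G.restrict K).componentOf x)) '' G.vertexSet :=
    Set.image_image _ _ _
  unfold numComponents
  rw [this]
  refine Set.ncard_image_eq_of_iff fun x y => ?_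
  rw [componentOf_eq_iff, componentOf_eq_iff, G.reflTransGen_contract_iff hA]

end Graph

/-! ### Components, nullity and Euler genus on an interval -/

namespace RibbonGraph

variable {E : Type*}

theorem reflTransGen_spanning_of_boundaryAt_eq [DecidableEq E] (G : RibbonGraph E) {H : Finset E}
    {d d' : Corner E} (h : G.boundaryAt H d = G.boundaryAt H d') :
    Relation.ReflTransGen (G.spanning H).Adj (G.vertexAt d) (G.vertexAt d') := by
  refine G.boundaryAt_induction H
    (P := fun c => Relation.ReflTransGen (G.spanning H).Adj (G.vertexAt d) (G.vertexAt c))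
    (fun c hc => by rwa [vertexAt_arc]) (fun c hc => ?_) h Relation.ReflTransGen.refl
  by_cases hcH : c.1 ∈ H
  · rw [boundaryStep, if_pos hcH]
    refine hc.tail ⟨c.1, hcH, c.2.1, ?_, ?_⟩
    · exact G.vertexAt_side _ _ _
    · exact G.vertexAt_side _ _ _
  · rwa [boundaryStep, if_neg hcH, vertexAt_alongEnd]

theorem numComponents_spanning_insert [DecidableEq E] (G : RibbonGraph E) {H : Finset E} {e : E}
    (h : G.boundaryAt H (e, false, false) = G.boundaryAt H (e, true, false)) :
    (G.spanning (insert e H)).numComponents = (G.spanning H).numComponents := by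
  refine Set.ncard_image_eq_of_iff fun x y => ?_
  rw [Graph.componentOf_eq_iff, Graph.componentOf_eq_iff]
  have he := G.reflTransGen_spanning_of_boundaryAt_eq h
  constructor
  · intro hxy
    induction hxy with
    | refl => exact Relation.ReflTransGen.refl
    | tail _ hbc ih =>
      refine ih.trans ?_
      obtain ⟨f, hf, i, rfl, rfl⟩ := hbc
      rcases Finset.mem_insert.1 (Finset.mem_coe.1 hf) with rfl | hf
      · cases i
        · exact he
        · exact Graph.reflTransGen_symm _ he
      · exact .single ⟨f, hf, i, rfl, rfl⟩
  · exact G.toGraph.reflTransGen_restrict_mono (by simp)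

theorem numComponents_spanning_of_isQuasiTree [DecidableEq E] (G : RibbonGraph E)
    (hG : G.IsConnected) {Q : Finset E} (hQ : G.IsQuasiTree Q) :
    (G.spanning Q).numComponents = 1 := by
  have hsub := (Nat.card_eq_one_iff_unique.1 hQ).1
  have key : ∀ x y, Relation.ReflTransGen (G.spanning Q).Adj x y := by
    -- An isolated vertex is a boundary component by itself, so it can only occur as the sole
    -- vertex.
    have hinr : ∀ d i, G.boundaryAt Q d ≠ Sum.inr i := fun d i => Sum.inl_ne_inr
    rintro (q | i) (q' | i')
    · induction q using Quot.ind with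
      | mk d =>
        induction q' using Quot.ind with
        | mk d' => exact G.reflTransGen_spanning_of_boundaryAt_eq (Subsingleton.elim _ _)
    · induction q using Quot.ind with
      | mk d => exact absurd (hsub.elim _ _) (hinr d i')
    · induction q' using Quot.ind with
      | mk d => exact absurd (hsub.elim _ _) (hinr d i)
    · have : (Sum.inr i : G.BoundaryComponent Q) = Sum.inr i' := hsub.elim _ _
      rw [Sum.inr_injective this]
      exact Relation.ReflTransGen.refl
  obtain ⟨x⟩ := G.nonempty_vertex_of_isConnected hG
  refine Set.ncard_eq_one.2 ⟨(G.spanning Q).componentOf x, ?_⟩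
  ext C
  constructor
  · rintro ⟨y, -, rfl⟩
    exact Graph.componentOf_eq _ (key y x)
  · rintro rfl
    exact ⟨x, trivial, rfl⟩

theorem nullity_spanning_add [Finite E] (G : RibbonGraph E) (H : Finset E) :
    (G.spanning H).nullity + Nat.card G.Vertex = H.card + (G.spanning H).numComponents := by
  have h := (G.spanning H).nullity_add_card
  have hE : (G.spanning H).edgeSet = (H : Set E) := Set.univ_inter _
  have hV : (G.spanning H).vertexSet = Set.univ := rfl
  rwa [hE, hV, Set.ncard_univ, Set.ncard_coe_finset] at h

variable [LinearOrder E]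

theorem mem_VI (G : RibbonGraph E) {Q : Finset E} {e : E} :
    e ∈ G.VI Q ↔ e ∈ Q ∧ ¬ (G.IsLive Q e ∧ G.IsOrientableEdge Q e) := by
  simp only [VI, internalDead, internalLiveNonorientable, Finset.mem_union, Finset.mem_filter]
  tauto

theorem mem_internalLiveOrientable (G : RibbonGraph E) {Q : Finset E} {e : E} :
    e ∈ G.internalLiveOrientable Q ↔ e ∈ Q ∧ G.IsLive Q e ∧ G.IsOrientableEdge Q e := by
  simp [internalLiveOrientable]

theorem VI_union_internalLiveOrientable (G : RibbonGraph E) (Q : Finset E) :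
    G.VI Q ∪ G.internalLiveOrientable Q = Q := by
  ext e
  rw [Finset.mem_union, mem_VI, mem_internalLiveOrientable]
  tauto

theorem disjoint_VI_internalLiveOrientable (G : RibbonGraph E) (Q : Finset E) :
    Disjoint (G.VI Q) (G.internalLiveOrientable Q) := by
  rw [Finset.disjoint_left]
  intro e
  rw [mem_VI, mem_internalLiveOrientable]
  tauto

theorem numComponents_quasiTreeGraph_restrict (G : RibbonGraph E) (Q : Finset E) {A : Finset E}
    (hA : A ⊆ G.internalLiveOrientable Q) :
    ((G.quasiTreeGraph Q).restrict A).numComponents = (G.spanning (G.VI Q ∪ A)).numComponents := by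
  unfold quasiTreeGraph spanning
  rw [Finset.coe_union]
  exact G.toGraph.numComponents_contract (Finset.coe_subset.2 hA)

theorem edgeSet_quasiTreeGraph (G : RibbonGraph E) (Q : Finset E) :
    (G.quasiTreeGraph Q).edgeSet = G.internalLiveOrientable Q :=
  Set.univ_inter _

/-- Contracting `VI(Q)` in the connected graph `F_Q` leaves a connected graph. -/
theorem numComponents_quasiTreeGraph (G : RibbonGraph E) (hG : G.IsConnected) {Q : Finset E}
    (hQ : G.IsQuasiTree Q) : (G.quasiTreeGraph Q).numComponents = 1 := by
  have h : (G.quasiTreeGraph Q).restrict (G.internalLiveOrientable Q) = G.quasiTreeGraph Q := by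
    rw [Graph.restrict_eq_self_iff, edgeSet_quasiTreeGraph]
  rw [← h, numComponents_quasiTreeGraph_restrict _ _ subset_rfl, VI_union_internalLiveOrientable,
    G.numComponents_spanning_of_isQuasiTree hG hQ]

variable [Fintype E]

theorem nullity_quasiTreeGraph_restrict_add (G : RibbonGraph E) (Q : Finset E) {A : Finset E}
    (hA : A ⊆ G.internalLiveOrientable Q) :
    ((G.quasiTreeGraph Q).restrict A).nullity + (G.spanning (G.VI Q)).numComponents =
      A.card + (G.spanning (G.VI Q ∪ A)).numComponents := by
  have h := ((G.quasiTreeGraph Q).restrict A).nullity_add_card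
  have hE : ((G.quasiTreeGraph Q).restrict A).edgeSet = (A : Set E) := by
    rw [Graph.edgeSet_restrict, edgeSet_quasiTreeGraph, Set.inter_eq_right]
    exact Finset.coe_subset.2 hA
  rwa [hE, Set.ncard_coe_finset, numComponents_quasiTreeGraph_restrict _ _ hA] at h

theorem mem_externalLiveOrientable (G : RibbonGraph E) {Q : Finset E} {e : E} :
    e ∈ G.externalLiveOrientable Q ↔ e ∉ Q ∧ G.IsLive Q e ∧ G.IsOrientableEdge Q e := by
  simp [externalLiveOrientable]

theorem card_VI_union_union (G : RibbonGraph E) {Q A B : Finset E}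
    (hA : A ⊆ G.internalLiveOrientable Q) (hB : B ⊆ G.externalLiveOrientable Q) :
    (G.VI Q ∪ A ∪ B).card = (G.VI Q).card + A.card + B.card := by
  rw [Finset.card_union_of_disjoint, Finset.card_union_of_disjoint]
  · exact Finset.disjoint_of_subset_right hA (G.disjoint_VI_internalLiveOrientable Q)
  · rw [Finset.disjoint_left]
    intro e he heB
    refine (G.mem_externalLiveOrientable.1 (hB heB)).1 ?_
    rcases Finset.mem_union.1 he with h | h
    · exact (G.mem_VI.1 h).1
    · exact (G.mem_internalLiveOrientable.1 (hA h)).1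

/-- The subgraph is `Q Δ S` with `S = (I_o \ A) ∪ B`, and in the partial dual each edge of `S`
contributes one new boundary component. -/
theorem bc_VI_union_union (G : RibbonGraph E) {Q A B : Finset E} (hQ : G.IsQuasiTree Q)
    (hA : A ⊆ G.internalLiveOrientable Q) (hB : B ⊆ G.externalLiveOrientable Q) :
    G.bc (G.VI Q ∪ A ∪ B) + A.card = 1 + (G.internalLiveOrientable Q).card + B.card := by
  have hS : ∀ e ∈ (G.internalLiveOrientable Q \ A) ∪ B,
      G.IsLive Q e ∧ G.IsOrientableEdge Q e := by
    intro e he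
    rcases Finset.mem_union.1 he with h | h
    · exact (G.mem_internalLiveOrientable.1 (Finset.mem_sdiff.1 h).1).2
    · exact (G.mem_externalLiveOrientable.1 (hB h)).2
  have h := G.bc_partialDual_of_live_orientable hQ _ hS
  have hsymm : symmDiff Q ((G.internalLiveOrientable Q \ A) ∪ B) = G.VI Q ∪ A ∪ B := by
    ext e
    have h1 : e ∈ A → _ := fun h => G.mem_internalLiveOrientable.1 (hA h)
    have h2 : e ∈ B → _ := fun h => G.mem_externalLiveOrientable.1 (hB h)
    simp only [Finset.mem_symmDiff, Finset.mem_union, Finset.mem_sdiff, mem_VI,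
      mem_internalLiveOrientable]
    tauto
  have hcard : ((G.internalLiveOrientable Q \ A) ∪ B).card + A.card =
      (G.internalLiveOrientable Q).card + B.card := by
    rw [Finset.card_union_of_disjoint]
    · have := Finset.card_sdiff_add_card_eq_card hA
      omega
    · rw [Finset.disjoint_left]
      intro e he heB
      exact (G.mem_externalLiveOrientable.1 (hB heB)).1
        (G.mem_internalLiveOrientable.1 (Finset.mem_sdiff.1 he).1).1
  rw [bc_partialDual, hsymm] at h
  omega

/-- Each external edge raises `bc` by one. Hence its ends already lie on one boundary component, and
so in one connected component. -/
theorem numComponents_VI_union_union (G : RibbonGraph E) {Q A B : Finset E} (hQ : G.IsQuasiTree Q)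
    (hA : A ⊆ G.internalLiveOrientable Q) (hB : B ⊆ G.externalLiveOrientable Q) :
    (G.spanning (G.VI Q ∪ A ∪ B)).numComponents = (G.spanning (G.VI Q ∪ A)).numComponents := by
  induction B using Finset.induction_on with
  | empty => rw [Finset.union_empty]
  | insert e B he ih =>
    have hB' : B ⊆ G.externalLiveOrientable Q := (Finset.subset_insert e B).trans hB
    have h1 := G.bc_VI_union_union hQ hA hB
    have h2 := G.bc_VI_union_union hQ hA hB'
    have h3 := G.card_VI_union_union hA hB
    have h4 := G.card_VI_union_union hA hB'
    rw [Finset.card_insert_of_notMem he] at h1 h3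
    rw [Finset.union_insert] at h1 h3 ⊢
    rw [G.numComponents_spanning_insert, ih hB']
    refine G.boundaryAt_eq_of_bc_lt_insert (fun h => ?_) (by omega)
    rw [Finset.insert_eq_of_mem h] at h3
    omega

theorem nullity_VI_union_union (G : RibbonGraph E) {Q A B : Finset E} (hQ : G.IsQuasiTree Q)
    (hA : A ⊆ G.internalLiveOrientable Q) (hB : B ⊆ G.externalLiveOrientable Q) :
    (G.spanning (G.VI Q ∪ A ∪ B)).nullity = (G.spanning (G.VI Q)).nullity +
      ((G.quasiTreeGraph Q).restrict A).nullity + B.card := by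
  have h1 := G.nullity_spanning_add (G.VI Q ∪ A ∪ B)
  have h2 := G.nullity_spanning_add (G.VI Q)
  have h3 := G.nullity_quasiTreeGraph_restrict_add Q hA
  rw [G.card_VI_union_union hA hB, G.numComponents_VI_union_union hQ hA hB] at h1
  omega

/-- Here `B` adds equally to `n` and to `bc`. Adding `A` changes `c` by `n(G_Q|A) - |A|`, `n` by
`n(G_Q|A)` and `bc` by `-|A|`, so `c + n - bc` grows by twice the nullity. -/
theorem eulerGenus_VI_union_union (G : RibbonGraph E) {Q A B : Finset E} (hQ : G.IsQuasiTree Q)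
    (hA : A ⊆ G.internalLiveOrientable Q) (hB : B ⊆ G.externalLiveOrientable Q) :
    G.eulerGenus (G.VI Q ∪ A ∪ B) = G.eulerGenus (G.VI Q) +
      2 * ((G.quasiTreeGraph Q).restrict A).nullity := by
  have h1 := G.eulerGenus_add_bc (G.VI Q ∪ A ∪ B)
  have h2 := G.eulerGenus_add_bc (G.VI Q)
  have h3 := G.nullity_quasiTreeGraph_restrict_add Q hA
  have h4 := G.bc_VI_union_union hQ hA hB
  have h5 := G.bc_VI_union_union hQ (Finset.empty_subset _) (Finset.empty_subset _)
  rw [G.nullity_VI_union_union hQ hA hB, G.numComponents_VI_union_union hQ hA hB] at h1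
  simp only [Finset.union_empty, Finset.card_empty] at h5
  omega

/-! ### Summation over the intervals -/

/-- The spanning ribbon subgraphs are partitioned into intervals, one for each quasi-tree. -/
theorem sum_eq_sum_quasiTrees {M : Type*} [AddCommMonoid M] (G : RibbonGraph E)
    (hG : G.IsConnected) (w : Finset E → M) :
    ∑ H, w H = ∑ Q ∈ G.quasiTrees, ∑ A ∈ (G.internalLiveOrientable Q).powerset,
      ∑ B ∈ (G.externalLiveOrientable Q).powerset, w (G.VI Q ∪ A ∪ B) := by
  classical
  let C : Finset E → Finset E → Prop := fun Q H =>
    ∀ e, ¬ (G.IsLive Q e ∧ G.IsOrientableEdge Q e) → (e ∈ Q ↔ e ∈ H)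
  have h1 : ∀ H, w H = ∑ Q ∈ G.quasiTrees.filter (C · H), w H := by
    intro H
    obtain ⟨Q, hQ, huniq⟩ := G.existsUnique_quasiTree hG H
    have : G.quasiTrees.filter (C · H) = {Q} := by
      ext Q'
      rw [Finset.mem_filter, Finset.mem_singleton]
      exact ⟨huniq Q', fun h => h ▸ hQ⟩
    rw [this, Finset.sum_singleton]
  -- Double counting of the pairs `(Q, H)` with `H` in the interval of `Q`.
  rw [Finset.sum_congr rfl fun H _ => h1 H, Finset.sum_comm' (t' := G.quasiTrees)
    (s' := fun Q => Finset.univ.filter (C Q)) (by simp [and_comm])]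
  refine Finset.sum_congr rfl fun Q _ => ?_
  rw [← Finset.sum_product']
  refine Finset.sum_nbij' (fun H => (H ∩ G.internalLiveOrientable Q,
    H ∩ G.externalLiveOrientable Q)) (fun p => G.VI Q ∪ p.1 ∪ p.2) ?_ ?_ ?_ ?_ ?_
  · intro H _
    simp
  · rintro ⟨A, B⟩ hAB
    simp only [Finset.mem_product, Finset.mem_powerset] at hAB
    simp only [Finset.mem_filter, Finset.mem_univ, true_and]
    intro e he
    have h1 : e ∈ A → _ := fun h => G.mem_internalLiveOrientable.1 (hAB.1 h)
    have h2 : e ∈ B → _ := fun h => G.mem_externalLiveOrientable.1 (hAB.2 h)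
    simp only [Finset.mem_union, mem_VI]
    tauto
  · intro H hH
    have hH' := (Finset.mem_filter.1 hH).2
    ext e
    have := hH' e
    simp only [Finset.mem_union, Finset.mem_inter, mem_VI, mem_internalLiveOrientable,
      mem_externalLiveOrientable]
    tauto
  · rintro ⟨A, B⟩ hAB
    simp only [Finset.mem_product, Finset.mem_powerset] at hAB
    refine Prod.ext ?_ ?_ <;> ext e
    all_goals
      have h1 : e ∈ A → _ := fun h => G.mem_internalLiveOrientable.1 (hAB.1 h)
      have h2 : e ∈ B → _ := fun h => G.mem_externalLiveOrientable.1 (hAB.2 h)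
      simp only [Finset.mem_union, Finset.mem_inter, mem_VI, mem_internalLiveOrientable,
        mem_externalLiveOrientable]
      tauto
  · intro H hH
    have hH' := (Finset.mem_filter.1 hH).2
    congr 1
    ext e
    have := hH' e
    simp only [Finset.mem_union, Finset.mem_inter, mem_VI, mem_internalLiveOrientable,
      mem_externalLiveOrientable]
    tauto

theorem tuttePolynomial_quasiTreeGraph (G : RibbonGraph E) (hG : G.IsConnected) {Q : Finset E}
    (hQ : G.IsQuasiTree Q) :
    (G.quasiTreeGraph Q).tuttePolynomial = ∑ A ∈ (G.internalLiveOrientable Q).powerset,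
      MvPolynomial.X 0 ^ ((G.spanning (G.VI Q ∪ A)).numComponents - 1) *
        MvPolynomial.X 1 ^ ((G.quasiTreeGraph Q).restrict A).nullity := by
  unfold Graph.tuttePolynomial
  refine Finset.sum_congr ?_ fun A hA => ?_
  · ext A
    simp [edgeSet_quasiTreeGraph]
  · rw [numComponents_quasiTreeGraph_restrict _ _ (Finset.mem_powerset.1 hA),
      numComponents_quasiTreeGraph _ hG hQ]

end RibbonGraph

theorem mainTheorem5 {E : Type*} [Fintype E] [LinearOrder E] (G : RibbonGraph E)
    (hG : G.IsConnected) :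
    G.bollobasRiordan =
      ∑ Q ∈ G.quasiTrees,
        (MvPolynomial.X 1 : MvPolynomial (Fin 3) ℤ) ^ (G.spanning (G.VI Q)).nullity *
          MvPolynomial.X 2 ^ G.eulerGenus (G.VI Q) *
          (1 + MvPolynomial.X 1) ^ (G.externalLiveOrientable Q).card *
          MvPolynomial.aeval ![MvPolynomial.X 0, MvPolynomial.X 1 * MvPolynomial.X 2 ^ 2]
            (G.quasiTreeGraph Q).tuttePolynomial := by
  unfold RibbonGraph.bollobasRiordan
  rw [G.sum_eq_sum_quasiTrees hG]
  refine Finset.sum_congr rfl fun Q hQ => ?_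
  rw [G.mem_quasiTrees] at hQ
  have hG1 : G.toGraph.numComponents = 1 := hG
  rw [G.tuttePolynomial_quasiTreeGraph hG hQ, map_sum, Finset.mul_sum]
  refine Finset.sum_congr rfl fun A hA => ?_
  -- By the binomial expansion over subsets, `(Y + 1)^|E_o|` is the sum of `Y^|B|` over `B ⊆ E_o`.
  rw [add_comm 1 (MvPolynomial.X 1), ← Finset.sum_pow_mul_eq_add_pow, Finset.mul_sum,
    Finset.sum_mul]
  refine Finset.sum_congr rfl fun B hB => ?_
  rw [Finset.mem_powerset] at hA hB
  rw [G.nullity_VI_union_union hQ hA hB, G.eulerGenus_VI_union_union hQ hA hB,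
    G.numComponents_VI_union_union hQ hA hB, hG1]
  simp only [map_mul, map_pow, MvPolynomial.aeval_X, Matrix.cons_val_zero, Matrix.cons_val_one,
    one_pow, mul_one]
  ring
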